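/- Let $p$ be a prime and let $A=\mathbb{Q}_p\langle T\rangle$ be the Tate algebra in one variable, i.e. the algebra of power series over $\mathbb{Q}_p$ whose coefficients tend to $0$. Let $\Omega^1_{A/\mathbb{Q}_p}$ be the module of Kähler differentials, let $\Omega^{\mathrm{rig}}=A\,dT$ be the free module of rank one with the derivation $d f=f'\,dT$, and let $\pi:\Omega^1_{A/\mathbb{Q}_p}\to\Omega^{\mathrm{rig}}$ be the $A$-linear map with $\pi(df)=f'\,dT$. Then the following hold. (1) $A$ is an affinoid $\mathbb{Q}_p$-algebra, and there is a finitely generated $A$-module $M$ such that $\operatorname{Ext}^1_A(\Omega^1_{A/\mathbb{Q}_p},M)\neq 0$ and such that there is a square-zero extension $0\to M\to E\to A\to 0$ of $A$ by $M$ over $\mathbb{Q}_p$ (where $E$ is a commutative $\mathbb{Q}_p$-algebra, $E\to A$ is a surjective $\mathbb{Q}_p$-algebra homomorphism, its kernel is an ideal of square zero, and this kernel is isomorphic to $M$ as an $A$-module) for which $E$ is not an affinoid $\mathbb{Q}_p$-algebra, i.e. not a quotient of any Tate algebra $\mathbb{Q}_p\langle X_1,\dots,X_n\rangle$. (2) $\Omega^{\mathrm{rig}}$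 with $d$ is the rigid differential module of $A$: it is finitely generated and $d$ is universal among $\mathbb{Q}_p$-derivations of $A$ into finitely generated $A$-modules. The map $\pi$ is surjective. (3) The $A$-module $\operatorname{Ker}(\pi)$ is divisible and injective, and it is not projective. It is non-zero: put $c=p$ if $p$ is odd and $c=4$ if $p=2$; then $\exp(cT)=\sum_{n\ge 0}c^nT^n/n!$ lies in $A$, and $$d(\exp(cT))-c\exp(cT)\,dT\in\Omega^1_{A/\mathbb{Q}_p}$$ is a non-zero element of $\operatorname{Ker}(\pi)$. -/

import Mathlib

open CategoryTheory
open scoped KaehlerDifferential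

noncomputable section

/-- The Tate algebra `K⟨X_s : s ∈ σ⟩`: power series over `K` whose coefficients tend to `0`. -/
def tateAlgebra (K : Type*) [NontriviallyNormedField K] [IsUltrametricDist K] (σ : Type*) :
    Subalgebra K (MvPowerSeries σ K) where
  __ := MvPowerSeries.IsRestricted.subring (R := K) (σ := σ) (fun _ => 1)
  algebraMap_mem' a := MvPowerSeries.isRestricted_C (fun _ => 1) a

/-- An affinoid `K`-algebra is a quotient of a Tate algebra in finitely many variables. -/
def IsAffinoidAlgebra (K : Type*) [NontriviallyNormedField K] [IsUltrametricDist K]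
    (B : Type*) [CommRing B] [Algebra K B] : Prop :=
  ∃ (n : ℕ) (φ : tateAlgebra K (Fin n) →ₐ[K] B), Function.Surjective φ

/-- The Tate algebra `K⟨T⟩` in one variable. (`PowerSeries K` is `MvPowerSeries Unit K`.) -/
abbrev Tate (K : Type*) [NontriviallyNormedField K] [IsUltrametricDist K] : Type _ :=
  tateAlgebra K Unit

namespace Tate

variable {K : Type*} [NontriviallyNormedField K] [IsUltrametricDist K]

/-- The power series underlying an element of `K⟨T⟩`. -/
def toPowerSeries (f : Tate K) : PowerSeries K := f.1

theorem mem_iff (f : PowerSeries K) :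
    f ∈ tateAlgebra K Unit ↔
      Filter.Tendsto (fun n : ℕ => ‖PowerSeries.coeff n f‖) Filter.atTop (nhds 0) := by
  have h := PowerSeries.isRestricted_iff' (1 : ℝ) f
  simp only [one_pow, mul_one] at h
  exact h

theorem derivative_mem (f : Tate K) :
    PowerSeries.derivative K f.toPowerSeries ∈ tateAlgebra K Unit := by
  have hf := (mem_iff f.toPowerSeries).1 f.2
  rw [mem_iff]
  refine squeeze_zero (fun _ => norm_nonneg _) (fun n => ?_)
    (hf.comp (Filter.tendsto_add_atTop_nat 1))
  have h1 : ‖((n + 1 : ℕ) : K)‖ ≤ 1 := IsUltrametricDist.norm_natCast_le_one K (n + 1)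
  rw [PowerSeries.coeff_derivative, norm_mul]
  push_cast at h1
  exact mul_le_of_le_one_right (norm_nonneg _) h1

/-- The derivation `d/dT` of `K⟨T⟩`. -/
def deriv (K : Type*) [NontriviallyNormedField K] [IsUltrametricDist K] :
    Derivation K (Tate K) (Tate K) where
  toFun f := ⟨PowerSeries.derivative K f.toPowerSeries, derivative_mem f⟩
  map_add' f g := Subtype.ext ((PowerSeries.derivative K).map_add f.1 g.1)
  map_smul' c f := Subtype.ext ((PowerSeries.derivative K).map_smul c f.1)
  map_one_eq_zero' := Subtype.ext (PowerSeries.derivative K).map_one_eq_zero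
  leibniz' f g := Subtype.ext ((PowerSeries.derivative K).leibniz f.1 g.1)

/-- The rigid differential module `Ω^rig` of `K⟨T⟩`: the free module `K⟨T⟩ · dT`, whose basis
element `dT` is written `1`. -/
abbrev OmegaRig (K : Type*) [NontriviallyNormedField K] [IsUltrametricDist K] : Type _ := Tate K

/-- The rigid differential `d : K⟨T⟩ → Ω^rig`, `d f = f' dT`. -/
def dRig (K : Type*) [NontriviallyNormedField K] [IsUltrametricDist K] :
    Derivation K (Tate K) (OmegaRig K) := deriv K

/-- The canonical map `π : Ω¹_{A/K} → Ω^rig` with `π (d f) = d f`, for `A = K⟨T⟩`. -/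
def toOmegaRig (K : Type*) [NontriviallyNormedField K] [IsUltrametricDist K] :
    Ω[Tate K⁄K] →ₗ[Tate K] OmegaRig K := (dRig K).liftKaehlerDifferential

/-- The variable `T` of `K⟨T⟩`. -/
def T (K : Type*) [NontriviallyNormedField K] [IsUltrametricDist K] : Tate K :=
  ⟨(PowerSeries.X : PowerSeries K),
    MvPowerSeries.isRestricted_monomial (fun _ : Unit => 1) (Finsupp.single () 1) 1⟩

end Tate

/-- `(Ω, d)` is the (universal finite) differential module of the affinoid algebra `A` over `K`:
`Ω` is finitely generated and `d` is universal among `K`-derivations into finitely generated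
`A`-modules. -/
def IsUniversalFiniteDerivation {K A : Type} [Field K] [CommRing A] [Algebra K A]
    {W : Type} [AddCommGroup W] [Module A W] [Module K W]
    (d : Derivation K A W) : Prop :=
  Module.Finite A W ∧
    ∀ (N : Type) [AddCommGroup N] [Module A N] [Module K N] [IsScalarTower K A N]
      [Module.Finite A N] (D : Derivation K A N),
      ∃! φ : W →ₗ[A] N, ∀ a, φ (d a) = D a

/-- `0 → M → E → B → 0` is a square-zero extension of the `K`-algebra `B` by the `B`-module `M`:
`π` is a surjective `K`-algebra homomorphism, `i` is an injection onto `ker π`, `i(M)² = 0`, and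
the `B`-module structure which `i(M) = ker π` then inherits from `E` is the given one on `M`. -/
structure IsSquareZeroExtension (K : Type*) {B M E : Type*} [CommRing K]
    [CommRing B] [Algebra K B] [AddCommGroup M] [Module B M] [CommRing E] [Algebra K E]
    (i : M →+ E) (π : E →ₐ[K] B) : Prop where
  injective : Function.Injective i
  exact : Function.Exact i π
  surjective : Function.Surjective π
  mul_eq_zero : ∀ m m' : M, i m * i m' = 0
  map_smul : ∀ (e : E) (m : M), i (π e • m) = e * i m

/-- `p` for an odd prime `p`, and `4` for `p = 2`: the series `exp (cT)` is then in `ℚ_p⟨T⟩`. -/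
def expScale (p : ℕ) [Fact p.Prime] : ℚ_[p] := if p = 2 then 4 else (p : ℚ_[p])

end

/-! Write `A` for `Tate K`. Weierstrass division makes `A` a principal ideal ring in which every
element is a polynomial modulo any given non-zero element, and every non-zero element divides a
non-zero polynomial.

If a derivation `D` of `A` kills `T`, it kills all polynomials, so `f = q * P + r` with `P`, `r`
polynomials gives `D f = P • D q`: its values are infinitely divisible. Krull's intersection theorem
then forces `D = 0` when the target is finitely generated, which is the universality of `dRig`. The
kernel of `π` is spanned by the values of the derivation `correction`, `f ↦ D f - f' D T`, which
kills `T`. So the kernel is divisible, hence injective by Baer's criterion; a non-zero `T`-divisible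
module is not projective over `A`.

The series `e = exp (cT)` is transcendental over `K[T]`. In characteristic zero some derivation into
the fraction field therefore kills `T` and sends `e` to `1`, so `correction D e` is not torsion.

For `Ext¹`, take `M = A` and the sequence `0 → A → K⟦X⟧ → K⟦X⟧/A → 0`. The quotient is injective, so
some `φ : Ω¹ → K⟦X⟧/A` does not kill `correction D e`. A lift to `K⟦X⟧` would be a derivation into a
`T`-adically separated module and would kill it.

The same `φ` gives a derivation `δ` and the extension `E` of pairs `a + y ε` with `y` in the class
`δ a`. If `E` were affinoid, a multiple `p ^ N • t` of a lift `t` of `T` could be substituted into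
convergent series. This forces `correction δ` to vanish at `e(p ^ N T) = e ^ (p ^ N)`, hence at `e`,
because `e` and `p ^ N` are units. -/

open CategoryTheory
open scoped KaehlerDifferential

noncomputable section

namespace Tate

open Filter Topology

/-! ### Coefficients, Gauss norm bounds and convergence -/

section Basic

variable {K : Type*} [NontriviallyNormedField K] [IsUltrametricDist K]

/-- The coefficient of `T ^ n`, as a linear form on `K⟨T⟩`. -/
def coeff (n : ℕ) : Tate K →ₗ[K] K :=
  (PowerSeries.coeff n).comp (tateAlgebra K Unit).val.toLinearMap

theorem coeff_eq (n : ℕ) (f : Tate K) : coeff n f = PowerSeries.coeff n f.toPowerSeries := rfl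

@[ext]
theorem ext {f g : Tate K} (h : ∀ n, coeff n f = coeff n g) : f = g :=
  Subtype.ext (PowerSeries.ext h)

theorem tendsto_coeff (f : Tate K) : Tendsto (fun n => ‖coeff n f‖) atTop (𝓝 0) :=
  (mem_iff f.toPowerSeries).1 f.2

theorem exists_of_tendsto (a : ℕ → K) (h : Tendsto (fun n => ‖a n‖) atTop (𝓝 0)) :
    ∃ f : Tate K, ∀ n, coeff n f = a n :=
  ⟨⟨PowerSeries.mk a, (mem_iff _).2 (by simpa using h)⟩, fun n => PowerSeries.coeff_mk n a⟩

theorem coeff_mul (n : ℕ) (f g : Tate K) :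
    coeff n (f * g) = ∑ q ∈ Finset.HasAntidiagonal.antidiagonal n, coeff q.1 f * coeff q.2 g :=
  PowerSeries.coeff_mul n f.toPowerSeries g.toPowerSeries

theorem coeff_zero_T_mul (f : Tate K) : coeff 0 (T K * f) = 0 :=
  PowerSeries.coeff_zero_X_mul f.toPowerSeries

theorem coeff_succ_T_mul (n : ℕ) (f : Tate K) : coeff (n + 1) (T K * f) = coeff n f :=
  PowerSeries.coeff_succ_X_mul n f.toPowerSeries

theorem coeff_algebraMap (n : ℕ) (a : K) :
    coeff n (algebraMap K (Tate K) a) = if n = 0 then a else 0 :=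
  PowerSeries.coeff_C n a

theorem coeff_deriv (n : ℕ) (f : Tate K) : coeff n (deriv K f) = coeff (n + 1) f * (n + 1) :=
  PowerSeries.coeff_derivative f.toPowerSeries n

theorem deriv_T : deriv K (T K) = 1 := Subtype.ext PowerSeries.derivative_X

theorem exists_eq_add_T_mul (f : Tate K) :
    ∃ g : Tate K, f = algebraMap K (Tate K) (coeff 0 f) + T K * g := by
  obtain ⟨g, hg⟩ := exists_of_tendsto (fun n => coeff (n + 1) f)
    ((tendsto_coeff f).comp (tendsto_add_atTop_nat 1))
  refine ⟨g, ext fun n => ?_⟩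
  rw [map_add, coeff_algebraMap]
  rcases n with _ | n
  · simp [coeff_zero_T_mul]
  · simp [coeff_succ_T_mul, hg]

theorem coeff_aeval_T (n : ℕ) (P : Polynomial K) :
    coeff n (Polynomial.aeval (T K) P) = P.coeff n := by
  have h : (Polynomial.aeval (T K) P).toPowerSeries = (P : PowerSeries K) := by
    change (tateAlgebra K Unit).val (Polynomial.aeval (T K) P) = (P : PowerSeries K)
    rw [← Polynomial.aeval_algHom_apply]
    change Polynomial.aeval (PowerSeries.X : PowerSeries K) P = _
    induction P using Polynomial.induction_on' with
    | add p q hp hq => simp [hp, hq]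
    | monomial n a =>
      rw [Polynomial.aeval_monomial, Polynomial.coe_monomial]
      ext m
      rw [PowerSeries.coeff_monomial, ← Algebra.smul_def, map_smul, PowerSeries.coeff_X_pow]
      simp
  rw [coeff_eq, h, Polynomial.coeff_coe]

theorem aeval_T_injective : Function.Injective (Polynomial.aeval (R := K) (T K)) := by
  intro P Q h
  ext n
  rw [← coeff_aeval_T, h, coeff_aeval_T]

theorem deriv_aeval_T (P : Polynomial K) :
    deriv K (Polynomial.aeval (T K) P) = Polynomial.aeval (T K) (Polynomial.derivative P) := by
  rw [(deriv K).map_aeval, deriv_T, smul_eq_mul, mul_one]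

/-- All coefficients of `f` have norm at most `c`. -/
def IsBoundedBy (f : Tate K) (c : ℝ) : Prop := ∀ n, ‖coeff n f‖ ≤ c

namespace IsBoundedBy

theorem add {f g : Tate K} {c : ℝ} (hf : IsBoundedBy f c) (hg : IsBoundedBy g c) :
    IsBoundedBy (f + g) c := fun n => by
  rw [map_add]
  exact (IsUltrametricDist.norm_add_le_max _ _).trans (max_le (hf n) (hg n))

theorem neg {f : Tate K} {c : ℝ} (hf : IsBoundedBy f c) : IsBoundedBy (-f) c := fun n => by
  rw [map_neg, norm_neg]
  exact hf n

theorem sub {f g : Tate K} {c : ℝ} (hf : IsBoundedBy f c) (hg : IsBoundedBy g c) :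
    IsBoundedBy (f - g) c := by
  rw [sub_eq_add_neg]
  exact hf.add hg.neg

theorem nonneg {f : Tate K} {c : ℝ} (hf : IsBoundedBy f c) : 0 ≤ c :=
  (norm_nonneg _).trans (hf 0)

theorem mul {f g : Tate K} {c d : ℝ} (hf : IsBoundedBy f c) (hg : IsBoundedBy g d) :
    IsBoundedBy (f * g) (c * d) := fun n => by
  rw [coeff_mul]
  refine IsUltrametricDist.norm_sum_le_of_forall_le_of_nonneg (mul_nonneg hf.nonneg hg.nonneg)
    fun q _ => ?_
  rw [norm_mul]
  exact mul_le_mul (hf _) (hg _) (norm_nonneg _) hf.nonneg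

end IsBoundedBy

theorem exists_isBoundedBy (f : Tate K) : ∃ c, IsBoundedBy f c := by
  obtain ⟨c, hc⟩ := (tendsto_coeff f).bddAbove_range
  exact ⟨c, fun n => hc ⟨n, rfl⟩⟩

theorem eq_zero_of_isBoundedBy_pow {f : Tate K} {c ε : ℝ} (h0 : 0 ≤ ε) (h1 : ε < 1)
    (hf : ∀ N, IsBoundedBy f (c * ε ^ N)) : f = 0 := by
  ext n
  rw [map_zero, ← norm_le_zero_iff]
  have h := (tendsto_pow_atTop_nhds_zero_of_lt_one h0 h1).const_mul c
  rw [mul_zero] at h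
  exact ge_of_tendsto' h fun N => hf N n

/-- Completeness of `A` for the Gauss norm, for geometrically bounded series: sum coefficientwise,
the ultrametric inequality bounding each tail by its first term's bound. -/
theorem exists_isBoundedBy_sub_sum [CompleteSpace K] {c ε : ℝ} (h0 : 0 ≤ ε) (h1 : ε < 1)
    (q : ℕ → Tate K) (hq : ∀ k, IsBoundedBy (q k) (c * ε ^ k)) :
    ∃ Q : Tate K, ∀ N, IsBoundedBy (Q - ∑ k ∈ Finset.range N, q k) (c * ε ^ N) := by
  have hc : 0 ≤ c := by simpa using (hq 0).nonneg
  have hlim : Tendsto (fun N => c * ε ^ N) atTop (𝓝 0) := by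
    simpa using (tendsto_pow_atTop_nhds_zero_of_lt_one h0 h1).const_mul c
  have hs : ∀ n, Summable fun k => coeff n (q k) := fun n => by
    apply NonarchimedeanAddGroup.summable_of_tendsto_cofinite_zero
    rw [Nat.cofinite_eq_atTop]
    exact squeeze_zero_norm (fun k => hq k n) hlim
  have hb : ∀ N n, ‖∑' k, coeff n (q k) - coeff n (∑ k ∈ Finset.range N, q k)‖ ≤ c * ε ^ N := by
    intro N n
    rw [map_sum, ← (hs n).sum_add_tsum_nat_add N, add_sub_cancel_left]
    refine IsUltrametricDist.norm_tsum_le_of_forall_le fun k => (hq _ n).trans ?_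
    exact mul_le_mul_of_nonneg_left (pow_le_pow_of_le_one h0 h1.le (Nat.le_add_left N k)) hc
  obtain ⟨Q, hQ⟩ := exists_of_tendsto (fun n => ∑' k, coeff n (q k)) (by
    rw [Metric.tendsto_atTop]
    intro η hη
    obtain ⟨N, hN⟩ := (hlim.eventually (gt_mem_nhds hη)).exists
    obtain ⟨m, hm⟩ := Metric.tendsto_atTop.1 (tendsto_coeff (∑ k ∈ Finset.range N, q k)) η hη
    refine ⟨m, fun n hn => ?_⟩
    have h2 := hm n hn
    rw [dist_zero_right, norm_norm] at h2 ⊢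
    have h3 := IsUltrametricDist.norm_add_le_max
      (∑' k, coeff n (q k) - coeff n (∑ k ∈ Finset.range N, q k))
      (coeff n (∑ k ∈ Finset.range N, q k))
    rw [sub_add_cancel] at h3
    exact h3.trans_lt (max_lt ((hb N n).trans_lt hN) h2))
  refine ⟨Q, fun N n => ?_⟩
  rw [map_sub, hQ]
  exact hb N n

end Basic

/-! ### Weierstrass division -/

section Division

variable {K : Type*} [NontriviallyNormedField K] [IsUltrametricDist K]

/-- `f` is distinguished of degree `s`: the coefficient of `T ^ s` is `1`, no coefficient is larger,
and the later ones are smaller. -/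
def IsDistinguished (f : Tate K) (s : ℕ) : Prop :=
  coeff s f = 1 ∧ (∀ n, ‖coeff n f‖ ≤ 1) ∧ ∀ n, s < n → ‖coeff n f‖ < 1

/-- Coefficients tend to `0`, so the largest norm is attained, and only finitely often; `s` is the
last index where it is, and one divides by that coefficient. -/
theorem exists_isDistinguished_smul {f : Tate K} (hf : f ≠ 0) :
    ∃ (a : K) (s : ℕ), a ≠ 0 ∧ IsDistinguished (a • f) s := by
  obtain ⟨n₀, hn₀⟩ : ∃ n, coeff n f ≠ 0 := by
    by_contra! h
    exact hf (ext h)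
  obtain ⟨m, hm⟩ := Metric.tendsto_atTop.1 (tendsto_coeff f) ‖coeff n₀ f‖ (norm_pos_iff.2 hn₀)
  simp only [dist_zero_right, norm_norm] at hm
  obtain ⟨i, hi, him⟩ := (Finset.range (m + 1)).exists_max_image (fun n => ‖coeff n f‖) ⟨0, by simp⟩
  have hmax : ∀ n, ‖coeff n f‖ ≤ ‖coeff i f‖ := by
    have h1 : ‖coeff n₀ f‖ ≤ ‖coeff i f‖ := by
      refine him _ (Finset.mem_range.2 ?_)
      by_contra! h
      exact lt_irrefl _ (hm n₀ (by omega))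
    intro n
    rcases lt_or_ge n m with h | h
    · exact him n (Finset.mem_range.2 (by omega))
    · exact (hm n h).le.trans h1
  have hi0 : 0 < ‖coeff i f‖ := (norm_pos_iff.2 hn₀).trans_le (hmax n₀)
  have hpos : ∃ b, ∀ n, b < n → ‖coeff n f‖ < ‖coeff i f‖ := by
    obtain ⟨m, hm⟩ := Metric.tendsto_atTop.1 (tendsto_coeff f) _ hi0
    simp only [dist_zero_right, norm_norm] at hm
    exact ⟨m, fun n hn => hm n hn.le⟩
  classical
  have hs := Nat.find_spec hpos
  have hs' : ‖coeff (Nat.find hpos) f‖ = ‖coeff i f‖ := by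
    refine le_antisymm (hmax _) ?_
    by_contra! h
    rcases hN : Nat.find hpos with _ | s
    · rw [hN] at h hs
      rcases Nat.eq_zero_or_pos i with hi' | hi'
      · rw [hi'] at h; exact lt_irrefl _ h
      · exact lt_irrefl _ (hs i hi')
    · refine Nat.find_min hpos (m := s) (by omega) fun n hn => ?_
      rcases Nat.eq_or_lt_of_le (Nat.succ_le_of_lt hn) with h' | h'
      · rw [hN] at h; rw [← h']; exact h
      · exact hs n (by rw [hN]; exact h')
  have hne : coeff (Nat.find hpos) f ≠ 0 := norm_pos_iff.1 (hs'.symm ▸ hi0)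
  refine ⟨(coeff (Nat.find hpos) f)⁻¹, Nat.find hpos, inv_ne_zero hne, ?_, fun n => ?_,
    fun n hn => ?_⟩
  · rw [map_smul, smul_eq_mul, inv_mul_cancel₀ hne]
  · rw [map_smul, smul_eq_mul, norm_mul, norm_inv, hs', inv_mul_le_iff₀ hi0, mul_one]
    exact hmax n
  · rw [map_smul, smul_eq_mul, norm_mul, norm_inv, hs', inv_mul_lt_iff₀ hi0, mul_one]
    exact hs n hn

/-- Division of polynomials by a monic polynomial with coefficients of norm at most `1` does not
increase the Gauss norm. -/
theorem exists_polynomial_division {P : Polynomial K} (hP : P.Monic)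
    (hP1 : ∀ n, ‖P.coeff n‖ ≤ 1) {δ : ℝ} (hδ : 0 ≤ δ) (d : ℕ) :
    ∀ g : Polynomial K, g.natDegree < d → (∀ n, ‖g.coeff n‖ ≤ δ) →
      ∃ q r : Polynomial K, g = q * P + r ∧ (∀ n, ‖q.coeff n‖ ≤ δ) ∧ (∀ n, ‖r.coeff n‖ ≤ δ) ∧
        ∀ n, P.natDegree ≤ n → r.coeff n = 0 := by
  induction d with
  | zero => intro g hg; omega
  | succ d ih =>
    intro g hg hgδ
    rcases lt_or_ge d P.natDegree with h | h
    · exact ⟨0, g, by simp, by simpa using hδ, hgδ, fun n hn =>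
        Polynomial.coeff_eq_zero_of_natDegree_lt (by omega)⟩
    · obtain ⟨j, rfl⟩ := Nat.exists_eq_add_of_le' h
      set m : Polynomial K := Polynomial.monomial j (g.coeff (j + P.natDegree)) with hm
      have hcoef : ∀ n, (m * P).coeff n =
          if j ≤ n then g.coeff (j + P.natDegree) * P.coeff (n - j) else 0 := by
        intro n
        split_ifs with hn
        · obtain ⟨i, rfl⟩ := Nat.exists_eq_add_of_le' hn
          rw [hm, Polynomial.coeff_monomial_mul, Nat.add_sub_cancel]
        · rw [hm, ← Polynomial.C_mul_X_pow_eq_monomial, mul_assoc, Polynomial.coeff_C_mul,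
            Polynomial.coeff_X_pow_mul', if_neg hn, mul_zero]
      have hb : ∀ n, ‖(m * P).coeff n‖ ≤ δ := fun n => by
        rw [hcoef]
        split_ifs
        · rw [norm_mul]
          exact (mul_le_of_le_one_right (norm_nonneg _) (hP1 _)).trans (hgδ _)
        · simpa using hδ
      obtain hd | hd := Nat.eq_zero_or_pos (j + P.natDegree)
      · have hP' : P = 1 := hP.natDegree_eq_zero.1 (by omega)
        subst hP'
        exact ⟨g, 0, by simp, hgδ, by simpa using hδ, by simp⟩
      have hlt : (g - m * P).natDegree < j + P.natDegree := by
        refine Nat.lt_of_le_pred hd (Polynomial.natDegree_le_iff_coeff_eq_zero.2 fun n hn' => ?_)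
        have hn : j + P.natDegree ≤ n := Nat.le_of_pred_lt hn'
        rw [Polynomial.coeff_sub, hcoef, if_pos (by omega)]
        rcases Nat.eq_or_lt_of_le hn with h' | h'
        · subst h'
          rw [Nat.add_sub_cancel_left, hP.coeff_natDegree, mul_one, sub_self]
        · rw [Polynomial.coeff_eq_zero_of_natDegree_lt (p := P) (by omega),
            Polynomial.coeff_eq_zero_of_natDegree_lt (p := g) (by omega), mul_zero, sub_zero]
      obtain ⟨q, r, h1, h2, h3, h4⟩ := ih (g - m * P) hlt fun n => by
        rw [Polynomial.coeff_sub, sub_eq_add_neg]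
        refine (IsUltrametricDist.norm_add_le_max _ _).trans (max_le (hgδ n) ?_)
        rw [norm_neg]
        exact hb n
      refine ⟨q + m, r, by rw [add_mul, add_right_comm, ← h1, sub_add_cancel], fun n => ?_, h3, h4⟩
      rw [Polynomial.coeff_add]
      refine (IsUltrametricDist.norm_add_le_max _ _).trans (max_le (h2 n) ?_)
      rw [hm, Polynomial.coeff_monomial]
      split_ifs
      · exact hgδ _
      · simpa using hδ

/-- The polynomial of degree `< d` obtained by truncating `f`. -/
theorem exists_truncation (f : Tate K) (d : ℕ) :
    ∃ P : Polynomial K, ∀ n, P.coeff n = if n < d then coeff n f else 0 :=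
  ⟨PowerSeries.trunc d f.toPowerSeries, fun n => PowerSeries.coeff_trunc n d _⟩

/-- Truncating `f` after `T ^ s` gives a monic polynomial `P` of norm at most `1` within `ε < 1` of
`f`. Divide a polynomial approximation `G` of `g` by `P`; the error is `(g - G) - q * (f - P)`. -/
theorem IsDistinguished.exists_approximate_division {f : Tate K} {s : ℕ}
    (hf : IsDistinguished f s) :
    ∃ ε : ℝ, 0 < ε ∧ ε < 1 ∧ ∀ (δ : ℝ) (g : Tate K), 0 < δ → IsBoundedBy g δ →
      ∃ q r : Tate K, IsBoundedBy q δ ∧ IsBoundedBy r δ ∧ (∀ n, s ≤ n → coeff n r = 0) ∧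
        IsBoundedBy (g - (q * f + r)) (δ * ε) := by
  obtain ⟨hs, h1, h2⟩ := hf
  obtain ⟨ε, he0, he1, he⟩ : ∃ ε : ℝ, 0 < ε ∧ ε < 1 ∧ ∀ n, s < n → ‖coeff n f‖ ≤ ε := by
    obtain ⟨m, hm⟩ := Metric.tendsto_atTop.1 (tendsto_coeff f) (1 / 2) (by norm_num)
    simp only [dist_zero_right, norm_norm] at hm
    -- The index `0`, given value `0`, only makes the finite set non-empty; genuine indices exceed
    -- `s`.
    obtain ⟨i, hi, him⟩ := (insert 0 ((Finset.range m).filter (s < ·))).exists_max_image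
      (fun n => if n = 0 then 0 else ‖coeff n f‖) ⟨0, by simp⟩
    have hilt : (if i = 0 then 0 else ‖coeff i f‖) < 1 := by
      split_ifs with hi0
      · norm_num
      · have := Finset.mem_insert.1 hi
        exact h2 i (Finset.mem_filter.1 (this.resolve_left hi0)).2
    refine ⟨max (1 / 2) (if i = 0 then 0 else ‖coeff i f‖), by positivity,
      max_lt (by norm_num) hilt, fun n hn => ?_⟩
    rcases lt_or_ge n m with h | h
    · have := him n (by simp [h, hn])
      rw [if_neg (by omega)] at this
      exact this.trans (le_max_right _ _)
    · exact (hm n h).le.trans (le_max_left _ _)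
  obtain ⟨P, hP⟩ := exists_truncation f (s + 1)
  have hdeg : P.natDegree = s := by
    refine Polynomial.natDegree_eq_of_le_of_coeff_ne_zero ?_ ?_
    · rw [Polynomial.natDegree_le_iff_coeff_eq_zero]
      intro n hn
      rw [hP, if_neg (by omega)]
    · rw [hP, if_pos (by omega), hs]; exact one_ne_zero
  have hmon : P.Monic := by
    rw [Polynomial.Monic, Polynomial.leadingCoeff, hdeg, hP, if_pos (by omega), hs]
  have hP1 : ∀ n, ‖P.coeff n‖ ≤ 1 := fun n => by
    rw [hP]
    split_ifs
    · exact h1 n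
    · simp
  have hfP : IsBoundedBy (f - Polynomial.aeval (T K) P) ε := fun n => by
    rw [map_sub, coeff_aeval_T, hP]
    split_ifs with hn
    · simpa using he0.le
    · simpa using he n (by omega)
  refine ⟨ε, he0, he1, fun δ g hδ hg => ?_⟩
  obtain ⟨m, hm⟩ := Metric.tendsto_atTop.1 (tendsto_coeff g) (δ * ε) (by positivity)
  simp only [dist_zero_right, norm_norm] at hm
  obtain ⟨G, hG⟩ := exists_truncation g m
  obtain ⟨q, r, hqr, hq, hr, hr0⟩ := exists_polynomial_division hmon hP1 hδ.le (G.natDegree + 1) G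
    (by omega) fun n => by
      rw [hG]
      split_ifs
      · exact hg n
      · simpa using hδ.le
  have hgG : IsBoundedBy (g - Polynomial.aeval (T K) G) (δ * ε) := fun n => by
    rw [map_sub, coeff_aeval_T, hG]
    split_ifs with hn
    · simpa using (mul_pos hδ he0).le
    · simpa using (hm n (by omega)).le
  have hq' : IsBoundedBy (Polynomial.aeval (T K) q) δ := fun n => by
    rw [coeff_aeval_T]; exact hq n
  refine ⟨Polynomial.aeval (T K) q, Polynomial.aeval (T K) r, hq',
    fun n => by rw [coeff_aeval_T]; exact hr n,
    fun n hn => by rw [coeff_aeval_T]; exact hr0 n (hdeg.trans_le hn), ?_⟩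
  have : g - (Polynomial.aeval (T K) q * f + Polynomial.aeval (T K) r) =
      g - Polynomial.aeval (T K) G -
        Polynomial.aeval (T K) q * (f - Polynomial.aeval (T K) P) := by
    rw [hqr, map_add, map_mul]; ring
  rw [this]
  exact hgG.sub (hq'.mul hfP)

/-- Weierstrass division. -/
theorem IsDistinguished.exists_division [CompleteSpace K] {f : Tate K} {s : ℕ}
    (hf : IsDistinguished f s) (g : Tate K) :
    ∃ (q : Tate K) (r : Polynomial K), r.degree < s ∧ g = q * f + Polynomial.aeval (T K) r := by
  obtain ⟨ε, he0, he1, step⟩ := hf.exists_approximate_division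
  obtain ⟨c, hc⟩ : ∃ c, 0 < c ∧ IsBoundedBy g c := by
    obtain ⟨c, hc⟩ := exists_isBoundedBy g
    exact ⟨max c 1, by positivity, fun n => (hc n).trans (le_max_left _ _)⟩
  choose! Q R hQ hR hR0 hstep using step
  -- `G k` is what is left of `g` after `k` approximate divisions; it shrinks like `ε ^ k`, and so
  -- do the successive quotients and remainders, which are then summed.
  let G : ℕ → Tate K := fun k =>
    k.rec g fun k h => h - (Q (c * ε ^ k) h * f + R (c * ε ^ k) h)
  have hG : ∀ k, IsBoundedBy (G k) (c * ε ^ k) := by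
    intro k
    induction k with
    | zero => simpa using! hc.2
    | succ k ih =>
      have := hstep (c * ε ^ k) (G k) (by have := hc.1; positivity) ih
      rwa [mul_assoc, ← pow_succ] at this
  have hpos : ∀ k, 0 < c * ε ^ k := fun k => by have := hc.1; positivity
  obtain ⟨q, hq⟩ := exists_isBoundedBy_sub_sum he0.le he1 (fun k => Q (c * ε ^ k) (G k))
    fun k => hQ _ _ (hpos k) (hG k)
  obtain ⟨r, hr⟩ := exists_isBoundedBy_sub_sum he0.le he1 (fun k => R (c * ε ^ k) (G k))
    fun k => hR _ _ (hpos k) (hG k)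
  have hsum : ∀ N, G N = g - ((∑ k ∈ Finset.range N, Q (c * ε ^ k) (G k)) * f +
      ∑ k ∈ Finset.range N, R (c * ε ^ k) (G k)) := by
    intro N
    induction N with
    | zero => simp [G]
    | succ N ih =>
      have : G (N + 1) = G N - (Q (c * ε ^ N) (G N) * f + R (c * ε ^ N) (G N)) := rfl
      rw [this, Finset.sum_range_succ, Finset.sum_range_succ]
      nth_rewrite 1 [ih]
      ring
  have hr0 : ∀ n, s ≤ n → coeff n r = 0 := by
    intro n hn
    rw [← norm_le_zero_iff]
    have h := (tendsto_pow_atTop_nhds_zero_of_lt_one he0.le he1).const_mul c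
    rw [mul_zero] at h
    refine ge_of_tendsto' h fun N => ?_
    have := hr N n
    rwa [map_sub, map_sum, Finset.sum_eq_zero fun k _ => hR0 _ _ (hpos k) (hG k) n hn,
      sub_zero] at this
  obtain ⟨P, hP⟩ := exists_truncation r s
  have hPr : Polynomial.aeval (T K) P = r := ext fun n => by
    rw [coeff_aeval_T, hP]
    split_ifs with hn
    · rfl
    · exact (hr0 n (not_lt.1 hn)).symm
  refine ⟨q, P, ?_, ?_⟩
  · rw [Polynomial.degree_lt_iff_coeff_zero]
    intro n hn
    rw [hP, if_neg (not_lt.2 hn)]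
  · rw [hPr, ← sub_eq_zero]
    refine eq_zero_of_isBoundedBy_pow (c := c) he0.le he1 fun N => ?_
    have : g - (q * f + r) = G N - (q - ∑ k ∈ Finset.range N, Q (c * ε ^ k) (G k)) * f -
        (r - ∑ k ∈ Finset.range N, R (c * ε ^ k) (G k)) := by
      rw [hsum N]; ring
    rw [this]
    refine ((hG N).sub ?_).sub (hr N)
    simpa using (hq N).mul (d := 1) hf.2.1

end Division

/-! ### Ideals of the Tate algebra -/

section Principal

variable {K : Type*} [NontriviallyNormedField K] [IsUltrametricDist K] [CompleteSpace K]

/-- A distinguished element of least degree in `I` generates it: a non-zero remainder, a polynomial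
of smaller degree in `I`, would rescale to a distinguished element of smaller degree. -/
instance : IsPrincipalIdealRing (Tate K) := by
  refine ⟨fun I => ?_⟩
  rcases eq_or_ne I ⊥ with rfl | hI
  · infer_instance
  have key : ∀ f ∈ I, f ≠ 0 → ∃ g ∈ I, ∃ a : K, ∃ s, g = a • f ∧ IsDistinguished g s := by
    intro f hf hf0
    obtain ⟨a, s, -, h⟩ := exists_isDistinguished_smul hf0
    exact ⟨a • f, Submodule.smul_of_tower_mem I a hf, a, s, rfl, h⟩
  have hex : ∃ s, ∃ f ∈ I, IsDistinguished f s := by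
    obtain ⟨f, hf, hf0⟩ := Submodule.exists_mem_ne_zero_of_ne_bot hI
    obtain ⟨g, hg, -, s, -, h⟩ := key f hf hf0
    exact ⟨s, g, hg, h⟩
  classical
  obtain ⟨f, hf, hfs⟩ := Nat.find_spec hex
  refine ⟨f, le_antisymm (fun g hg => ?_) ((Submodule.span_singleton_le_iff_mem _ _).2 hf)⟩
  obtain ⟨q, r, hr, hqr⟩ := hfs.exists_division g
  rw [Submodule.mem_span_singleton]
  by_cases hr0 : Polynomial.aeval (T K) r = 0
  · exact ⟨q, by rw [hqr, hr0, add_zero, smul_eq_mul]⟩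
  have hrI : Polynomial.aeval (T K) r ∈ I := by
    rw [← add_sub_cancel_left (q * f) (Polynomial.aeval (T K) r), ← hqr]
    exact I.sub_mem hg (I.mul_mem_left q hf)
  obtain ⟨h, hI', a, s, hah, hs⟩ := key _ hrI hr0
  exfalso
  refine Nat.find_min hex (m := s) ?_ ⟨h, hI', hs⟩
  by_contra! hle
  have h1 := hs.1
  rw [hah, map_smul, coeff_aeval_T, (Polynomial.degree_lt_iff_coeff_zero _ _).1 hr s hle,
    smul_zero] at h1
  exact zero_ne_one h1

/-- Every element is a polynomial modulo a given non-zero element. -/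
theorem exists_eq_mul_add_aeval {f : Tate K} (hf : f ≠ 0) (g : Tate K) :
    ∃ (q : Tate K) (r : Polynomial K), g = q * f + Polynomial.aeval (T K) r := by
  obtain ⟨a, s, -, h⟩ := exists_isDistinguished_smul hf
  obtain ⟨q, r, -, hqr⟩ := h.exists_division g
  exact ⟨a • q, r, by rw [hqr, mul_smul_comm, smul_mul_assoc]⟩

/-- Every non-zero element divides a non-zero polynomial. -/
theorem exists_dvd_aeval {f : Tate K} (hf : f ≠ 0) :
    ∃ P : Polynomial K, P ≠ 0 ∧ f ∣ Polynomial.aeval (T K) P := by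
  obtain ⟨a, s, -, h⟩ := exists_isDistinguished_smul hf
  -- Dividing `T ^ s` itself makes `X ^ s - r` monic, hence non-zero, and a multiple of `f`.
  obtain ⟨q, r, hr, hqr⟩ := h.exists_division (Polynomial.aeval (T K) ((Polynomial.X : Polynomial K) ^ s))
  refine ⟨Polynomial.X ^ s - r, (Polynomial.monic_X_pow_sub hr).ne_zero, a • q, ?_⟩
  rw [map_sub, hqr, add_sub_cancel_right, mul_smul_comm, mul_smul_comm, mul_comm]

end Principal

end Tate

/-- Baer's criterion over a principal ideal domain: divisible modules satisfy it. -/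
theorem Module.Baer.of_forall_exists_smul_eq {R Q : Type*} [CommRing R] [IsDomain R]
    [IsPrincipalIdealRing R] [AddCommGroup Q] [Module R Q]
    (h : ∀ a : R, a ≠ 0 → ∀ m : Q, ∃ n : Q, a • n = m) : Module.Baer R Q := by
  intro I g
  obtain ⟨a, rfl⟩ := (IsPrincipalIdealRing.principal I).principal
  rcases eq_or_ne a 0 with rfl | ha
  · refine ⟨0, fun x hx => ?_⟩
    have hx0 : x = 0 := by simpa using hx
    subst hx0
    exact (map_zero g).symm
  · obtain ⟨n, hn⟩ := h a ha (g ⟨a, Submodule.mem_span_singleton_self a⟩)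
    refine ⟨LinearMap.toSpanSingleton R Q n, fun x hx => ?_⟩
    obtain ⟨b, rfl⟩ := Submodule.mem_span_singleton.1 hx
    rw [LinearMap.toSpanSingleton_apply, smul_assoc, hn, ← map_smul]
    rfl

namespace Tate

/-! ### Derivations killing `T`, and the kernel of `π` -/

section Derivations

variable {K : Type*} [NontriviallyNormedField K] [IsUltrametricDist K]

theorem T_ne_zero : T K ≠ 0 := fun h => by
  have := congrArg (deriv K) h
  rw [deriv_T, map_zero] at this
  exact one_ne_zero this

theorem derivation_aeval_eq_zero {N : Type*} [AddCommGroup N] [Module (Tate K) N] [Module K N]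
    [IsScalarTower K (Tate K) N] {D : Derivation K (Tate K) N} (hT : D (T K) = 0)
    (P : Polynomial K) : D (Polynomial.aeval (T K) P) = 0 := by
  rw [D.map_aeval, hT, smul_zero]

/-- Divide: `f = q * P + r`. Since `D` kills the polynomials `P` and `r`, only `P • D q` survives.
-/
theorem exists_derivation_eq_aeval_smul [CompleteSpace K] {N : Type*} [AddCommGroup N]
    [Module (Tate K) N] [Module K N] [IsScalarTower K (Tate K) N] {D : Derivation K (Tate K) N}
    (hT : D (T K) = 0) {P : Polynomial K} (hP : P ≠ 0) (f : Tate K) :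
    ∃ q : Tate K, D f = Polynomial.aeval (T K) P • D q := by
  have h0 : Polynomial.aeval (T K) P ≠ 0 := by
    rw [← map_zero (Polynomial.aeval (R := K) (T K))]
    exact aeval_T_injective.ne hP
  obtain ⟨q, r, hf⟩ := exists_eq_mul_add_aeval h0 f
  refine ⟨q, ?_⟩
  rw [hf, map_add, D.leibniz, derivation_aeval_eq_zero hT, derivation_aeval_eq_zero hT, smul_zero,
    zero_add, add_zero]

/-- A derivation into a finitely generated module that kills `T` is zero. -/
theorem derivation_eq_zero [CompleteSpace K] {N : Type*} [AddCommGroup N]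
    [Module (Tate K) N] [Module K N] [IsScalarTower K (Tate K) N] [Module.Finite (Tate K) N]
    {D : Derivation K (Tate K) N} (hT : D (T K) = 0) : D = 0 := by
  ext f
  change D f = 0
  by_contra hf
  -- The annihilator of `D f` lies in a maximal ideal `I`. As `T` is a non-zero non-unit, `I ≠ 0`,
  -- so `I` contains a non-zero polynomial `P`. Now `D f` lies in every `P ^ k N`, and Krull gives
  -- `r ∈ (P)` with `r • D f = D f`; then `1 - r` and `r` are both in `I`.
  obtain ⟨I, hI, hle⟩ := Ideal.exists_le_maximal (Ideal.span {Submodule.IsPrincipal.generator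
    (LinearMap.ker (LinearMap.toSpanSingleton (Tate K) N (D f)))}) (by
      rw [Ideal.span_singleton_generator, Ne, Ideal.eq_top_iff_one, LinearMap.mem_ker,
        LinearMap.toSpanSingleton_apply, one_smul]
      exact hf)
  rw [Ideal.span_singleton_generator] at hle
  obtain ⟨g, hgI, hg0⟩ : ∃ g ∈ I, g ≠ 0 := by
    by_contra! h
    by_cases hu : IsUnit (T K)
    · obtain ⟨b, hb⟩ := hu.exists_right_inv
      have := congrArg (coeff 0) hb
      rw [coeff_zero_T_mul, ← map_one (algebraMap K (Tate K)), coeff_algebraMap] at this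
      simp at this
    · obtain ⟨J, hJ, hTJ⟩ := exists_max_ideal_of_mem_nonunits hu
      have hIJ : I ≤ J := fun x hx => by rw [h x hx]; exact J.zero_mem
      exact T_ne_zero (h _ ((hI.eq_of_le hJ.ne_top hIJ).symm ▸ hTJ))
  obtain ⟨P, hP, hgP⟩ := exists_dvd_aeval hg0
  have hmem : D f ∈ (⨅ i : ℕ, Ideal.span {Polynomial.aeval (T K) P} ^ i • ⊤ :
      Submodule (Tate K) N) := by
    rw [Submodule.mem_iInf]
    intro k
    obtain ⟨q, hq⟩ := exists_derivation_eq_aeval_smul hT (pow_ne_zero k hP) f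
    rw [hq, map_pow]
    exact Submodule.smul_mem_smul (Ideal.pow_mem_pow (Ideal.mem_span_singleton_self _) k) trivial
  obtain ⟨⟨r, hr⟩, hrD⟩ := (Ideal.mem_iInf_smul_pow_eq_bot_iff _ _).1 hmem
  have hrI : r ∈ I :=
    (Ideal.span_singleton_le_iff_mem I).2 (I.mem_of_dvd hgP hgI) hr
  have h1 : 1 - r ∈ I := hle (by
    rw [LinearMap.mem_ker, LinearMap.toSpanSingleton_apply, sub_smul, one_smul, sub_eq_zero]
    exact hrD.symm)
  exact hI.ne_top ((Ideal.eq_top_iff_one _).2 (by simpa using I.add_mem h1 hrI))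

section Kernel

variable {N : Type*} [AddCommGroup N] [Module (Tate K) N] [Module K N] [IsScalarTower K (Tate K) N]
  (D : Derivation K (Tate K) N)

/-- The derivation `f ↦ D f - f' D T` attached to a derivation `D` of `K⟨T⟩`. -/
def correction : Derivation K (Tate K) N :=
  D - (LinearMap.toSpanSingleton (Tate K) N (D (T K))).compDer (deriv K)

theorem correction_apply (f : Tate K) : correction D f = D f - deriv K f • D (T K) := rfl

theorem correction_T : correction D (T K) = 0 := by
  rw [correction_apply, deriv_T, one_smul, sub_self]

theorem correction_ne_zero {D : Derivation K (Tate K) N} {f : Tate K}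
    (h : ∀ a : Tate K, a • correction D f = 0 → a = 0) : correction D f ≠ 0 := fun h0 =>
  one_ne_zero (h 1 (by rw [h0, smul_zero]))

variable {D} {π : N →ₗ[Tate K] Tate K} (hπ : ∀ f, π (D f) = deriv K f)
include hπ

theorem correction_mem_ker (f : Tate K) : correction D f ∈ LinearMap.ker π := by
  rw [LinearMap.mem_ker, correction_apply, map_sub, map_smul, hπ, hπ, deriv_T,
    smul_eq_mul, mul_one, sub_self]

/-- The elements `y - π y • D T` all lie in the span of the corrections, by linearity from `y = D
f`; for `y` in the kernel this element is `y`. -/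
theorem ker_eq_span_correction (hD : Submodule.span (Tate K) (Set.range D) = ⊤) :
    LinearMap.ker π = Submodule.span (Tate K) (Set.range (correction D)) := by
  refine le_antisymm (fun x hx => ?_) (Submodule.span_le.2 ?_)
  · have h : ∀ y : N, y - π y • D (T K) ∈
        Submodule.span (Tate K) (Set.range (correction D)) := by
      intro y
      have hy : y ∈ Submodule.span (Tate K) (Set.range D) := by rw [hD]; trivial
      induction hy using Submodule.span_induction with
      | mem y hy =>
        obtain ⟨f, rfl⟩ := hy
        rw [hπ]
        exact Submodule.subset_span ⟨f, rfl⟩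
      | zero => rw [map_zero, zero_smul, sub_zero]; exact Submodule.zero_mem _
      | add y z _ _ hy hz =>
        have := Submodule.add_mem _ hy hz
        rwa [sub_add_sub_comm, ← add_smul, ← map_add] at this
      | smul a y _ hy =>
        have := Submodule.smul_mem _ a hy
        rwa [smul_sub, ← smul_assoc, ← map_smul π] at this
    have := h x
    rwa [LinearMap.mem_ker.1 hx, zero_smul, sub_zero] at this
  · rintro _ ⟨f, rfl⟩
    exact correction_mem_ker hπ f

/-- Some multiple `P = a * b` of `a` is a polynomial, so each generator is `P • correction D q = a •
(b • correction D q)`. -/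
theorem exists_smul_eq_of_mem_ker [CompleteSpace K]
    (hD : Submodule.span (Tate K) (Set.range D) = ⊤) {a : Tate K} (ha : a ≠ 0) {m : N}
    (hm : m ∈ LinearMap.ker π) : ∃ n ∈ LinearMap.ker π, a • n = m := by
  obtain ⟨P, hP, b, hb⟩ := exists_dvd_aeval ha
  rw [ker_eq_span_correction hπ hD] at hm
  induction hm using Submodule.span_induction with
  | mem y hy =>
    obtain ⟨f, rfl⟩ := hy
    obtain ⟨q, hq⟩ := exists_derivation_eq_aeval_smul (correction_T D) hP f
    exact ⟨b • correction D q, Submodule.smul_mem _ _ (correction_mem_ker hπ q), by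
      rw [hq, hb, ← smul_assoc, smul_eq_mul]⟩
  | zero => exact ⟨0, Submodule.zero_mem _, smul_zero a⟩
  | add y z _ _ hy hz =>
    obtain ⟨y, hy, rfl⟩ := hy
    obtain ⟨z, hz, rfl⟩ := hz
    exact ⟨y + z, Submodule.add_mem _ hy hz, smul_add a y z⟩
  | smul c y _ hy =>
    obtain ⟨y, hy, rfl⟩ := hy
    exact ⟨c • y, Submodule.smul_mem _ c hy, smul_comm a c y⟩

theorem injective_ker [CompleteSpace K] (hD : Submodule.span (Tate K) (Set.range D) = ⊤) :
    Module.Injective (Tate K) (LinearMap.ker π) := by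
  refine Module.Baer.injective (Module.Baer.of_forall_exists_smul_eq fun a ha m => ?_)
  obtain ⟨n, hn, h⟩ := exists_smul_eq_of_mem_ker hπ hD ha m.2
  exact ⟨⟨n, hn⟩, Subtype.ext h⟩

end Kernel

theorem toOmegaRig_D (f : Tate K) :
    toOmegaRig K (KaehlerDifferential.D K (Tate K) f) = deriv K f :=
  Derivation.liftKaehlerDifferential_comp_D _ _

theorem toOmegaRig_surjective : Function.Surjective (toOmegaRig K) := fun f =>
  ⟨f • KaehlerDifferential.D K (Tate K) (T K), by
    rw [map_smul, toOmegaRig_D, deriv_T, smul_eq_mul, mul_one]⟩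

theorem coeff_T_pow_mul (n : ℕ) : ∀ f : Tate K, coeff n (T K ^ (n + 1) * f) = 0 := by
  induction n with
  | zero => intro f; rw [zero_add, pow_one, coeff_zero_T_mul]
  | succ n ih => intro f; rw [pow_succ', mul_assoc, coeff_succ_T_mul, ih]

/-- A projective module on which `T` is surjective is zero. -/
theorem eq_zero_of_projective_of_T_smul_surjective {Q : Type*} [AddCommGroup Q] [Module (Tate K) Q]
    [Module.Projective (Tate K) Q] (h : ∀ m : Q, ∃ n : Q, T K • n = m) (m : Q) : m = 0 := by
  obtain ⟨s, hs⟩ := (Module.projective_def (R := Tate K) (P := Q)).1 inferInstance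
  have hpow : ∀ k, ∃ n : Q, T K ^ k • n = m := by
    intro k
    induction k with
    | zero => exact ⟨m, by rw [pow_zero, one_smul]⟩
    | succ k ih =>
      obtain ⟨n, hn⟩ := ih
      obtain ⟨n', rfl⟩ := h n
      exact ⟨n', by rw [pow_succ, ← smul_smul, hn]⟩
  -- In the free module containing `Q`, every coordinate of `m` is divisible by all powers of `T`,
  -- hence is `0`.
  apply hs.injective
  rw [map_zero]
  refine Finsupp.ext fun i => Tate.ext fun n => ?_
  obtain ⟨m', hm'⟩ := hpow (n + 1)
  rw [← hm', map_smul, Finsupp.smul_apply, smul_eq_mul, coeff_T_pow_mul]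
  simp

theorem not_projective_ker [CompleteSpace K] {N : Type*} [AddCommGroup N] [Module (Tate K) N]
    [Module K N] [IsScalarTower K (Tate K) N] {D : Derivation K (Tate K) N}
    {π : N →ₗ[Tate K] Tate K} (hπ : ∀ f, π (D f) = deriv K f)
    (hD : Submodule.span (Tate K) (Set.range D) = ⊤) {f : Tate K} (hf : correction D f ≠ 0) :
    ¬ Module.Projective (Tate K) (LinearMap.ker π) := by
  intro hproj
  have h0 := eq_zero_of_projective_of_T_smul_surjective (K := K) (Q := LinearMap.ker π) (fun m => by
    obtain ⟨n, hn, h⟩ := exists_smul_eq_of_mem_ker hπ hD T_ne_zero m.2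
    exact ⟨⟨n, hn⟩, Subtype.ext h⟩) ⟨_, correction_mem_ker hπ f⟩
  exact hf (congrArg Subtype.val h0)

end Derivations

theorem isUniversalFiniteDerivation_dRig {K : Type} [NontriviallyNormedField K]
    [IsUltrametricDist K] [CompleteSpace K] : IsUniversalFiniteDerivation (dRig K) := by
  refine ⟨inferInstance, fun N _ _ _ _ _ D => ?_⟩
  refine ⟨LinearMap.toSpanSingleton (Tate K) N (D (T K)), fun a => ?_, fun φ hφ => ?_⟩
  · let D' : Derivation K (Tate K) N :=
      D - (LinearMap.toSpanSingleton (Tate K) N (D (T K))).compDer (deriv K)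
    have hD' : D' = 0 := derivation_eq_zero (by
      change D (T K) - deriv K (T K) • D (T K) = 0
      rw [deriv_T, one_smul, sub_self])
    have := congrArg (fun D : Derivation K (Tate K) N => D a) hD'
    exact (sub_eq_zero.1 this).symm
  · refine LinearMap.ext_ring ?_
    rw [LinearMap.toSpanSingleton_apply, one_smul, ← hφ]
    exact congrArg φ deriv_T.symm

end Tate

open scoped TensorProduct IntermediateField.algebraAdjoinAdjoin in
/-- In characteristic zero a derivation can be prescribed on two algebraically independent
elements of a field. -/
theorem Derivation.exists_eq_zero_eq_one {K L : Type*} [Field K] [CharZero K] [Field L]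
    [Algebra K L] {x y : L} (hxy : x ≠ y) (h : AlgebraicIndepOn K id ({y, x} : Set L)) :
    ∃ Δ : Derivation K L L, Δ x = 0 ∧ Δ y = 1 := by
  -- Extend to a transcendence basis `s` and take `∂/∂y` on `K[s]`. It extends to `L` because `K[s]
  -- → K(s) → L` is formally étale: a localization, then an algebraic extension in characteristic
  -- zero.
  obtain ⟨s, hs, hb⟩ := exists_isTranscendenceBasis_superset h
  let S := Algebra.adjoin K (Set.range ((↑) : s → L))
  let F := IntermediateField.adjoin K (Set.range ((↑) : s → L))
  have : Algebra.FormallyEtale S F := .of_isLocalization (nonZeroDivisors S)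
  have : CharZero F := charZero_of_injective_algebraMap (algebraMap K F).injective
  have : Algebra.IsAlgebraic F L := hb.isAlgebraic_field
  have : Algebra.FormallyEtale F L := Algebra.FormallyEtale.of_isSeparable F L
  have : Algebra.FormallyEtale S L := .comp S F L
  let e : MvPolynomial s K ≃ₐ[K] S := hb.1.aevalEquiv
  let i : s := ⟨y, hs (by simp)⟩
  let D : Derivation K S L :=
    Derivation.mk' ((Algebra.linearMap S L).restrictScalars K ∘ₗ e.toLinearMap ∘ₗ
      (MvPolynomial.pderiv i).toLinearMap ∘ₗ e.symm.toLinearMap) fun a b => by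
        simp [Algebra.smul_def]
  have hD : ∀ j : s, D (e (MvPolynomial.X j)) = algebraMap S L (e (MvPolynomial.pderiv i (.X j))) :=
    fun j => by simp [D]
  have he : ∀ j : s, algebraMap S L (e (MvPolynomial.X j)) = j := fun j =>
    (hb.1.algebraMap_aevalEquiv _).trans (MvPolynomial.aeval_X _ j)
  let φ : Ω[L⁄K] →ₗ[L] L := D.liftKaehlerDifferential.liftBaseChange L ∘ₗ
    (KaehlerDifferential.tensorKaehlerEquivOfFormallyEtale K S L).symm.toLinearMap
  have hφ : ∀ a : S, φ (KaehlerDifferential.D K L (algebraMap S L a)) = D a := fun a => by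
    rw [LinearMap.comp_apply, LinearEquiv.coe_coe,
      KaehlerDifferential.tensorKaehlerEquivOfFormallyEtale_symm_D_algebraMap,
      LinearMap.liftBaseChange_tmul, one_smul, Derivation.liftKaehlerDifferential_comp_D]
  refine ⟨φ.compDer (KaehlerDifferential.D K L), ?_, ?_⟩
  · have := hφ (e (.X ⟨x, hs (by simp)⟩))
    rw [he, hD, MvPolynomial.pderiv_X_of_ne (by simpa [i] using hxy), map_zero, map_zero] at this
    exact this
  · have := hφ (e (.X i))
    rw [he, hD, MvPolynomial.pderiv_X_self, map_one, map_one] at this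
    exact this

namespace Tate

/-! ### Transcendence of the exponential over polynomials -/

section Transcendence

variable {K : Type*} [NontriviallyNormedField K] [IsUltrametricDist K] [CharZero K]

/-- Powers of a non-zero solution of `e' = c e`, `c ≠ 0`, are linearly independent over `K[T]`. -/
theorem eq_zero_of_sum_aeval_mul_pow_eq_zero {c : K} (hc : c ≠ 0) {e : Tate K} (he : e ≠ 0)
    (hde : deriv K e = c • e) (n : ℕ) : ∀ a : ℕ → Polynomial K,
      ∑ i ∈ Finset.range n, Polynomial.aeval (T K) (a i) * e ^ i = 0 → ∀ i < n, a i = 0 := by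
  induction n with
  | zero => intro a _ i hi; omega
  | succ n ih =>
    suffices H : ∀ (d : ℕ) (a : ℕ → Polynomial K), (a n).degree < d →
        ∑ i ∈ Finset.range (n + 1), Polynomial.aeval (T K) (a i) * e ^ i = 0 →
          ∀ i < n + 1, a i = 0 from fun a ha =>
      H ((a n).natDegree + 1) a
        (Polynomial.degree_le_natDegree.trans_lt (by exact_mod_cast Nat.lt_succ_self _)) ha
    intro d
    induction d with
    | zero =>
      intro a had ha i hi
      have hn : a n = 0 := by
        rw [← Polynomial.degree_eq_bot]
        exact Nat.WithBot.lt_zero_iff.1 (by simpa using had)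
      rw [Finset.sum_range_succ, hn, map_zero, zero_mul, add_zero] at ha
      rcases Nat.lt_succ_iff_lt_or_eq.1 hi with h | rfl
      · exact ih a ha i h
      · exact hn
    | succ d ihd =>
      intro a had ha
      -- Apply `d/dT - n c` to the relation. The top coefficient becomes `(a n)'`, of smaller
      -- degree, so induction gives `b = 0`; for `i < n` the leading coefficient of `a i` is
      -- multiplied by `(i - n) c ≠ 0`, so `a i = 0`.
      let b : ℕ → Polynomial K := fun i =>
        Polynomial.derivative (a i) + Polynomial.C (((i : K) - n) * c) * a i
      have hb : ∑ i ∈ Finset.range (n + 1), Polynomial.aeval (T K) (b i) * e ^ i = 0 := by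
        have h1 := congrArg (deriv K) ha
        rw [map_sum, map_zero] at h1
        have h2 : ∀ i, Polynomial.aeval (T K) (b i) * e ^ i =
            deriv K (Polynomial.aeval (T K) (a i) * e ^ i) -
              algebraMap K (Tate K) (n * c) * (Polynomial.aeval (T K) (a i) * e ^ i) := by
          intro i
          rw [(deriv K).leibniz, (deriv K).leibniz_pow, deriv_aeval_T, hde, map_add, map_mul,
            Polynomial.aeval_C, Algebra.smul_def c e]
          rcases i with _ | i
          · simp
            ring
          · simp only [Nat.add_sub_cancel, smul_eq_mul, nsmul_eq_mul, map_mul, map_sub,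
              map_natCast, Nat.cast_succ, map_add, map_one]
            ring
        simp only [h2]
        rw [Finset.sum_sub_distrib, h1, ← Finset.mul_sum, ha, mul_zero, sub_zero]
      have hbn : (b n).degree < d := by
        rw [Polynomial.degree_lt_iff_coeff_zero]
        intro m hm
        have : (a n).coeff (m + 1) = 0 :=
          (Polynomial.degree_lt_iff_coeff_zero _ _).1 had _ (by omega)
        simp [b, Polynomial.coeff_derivative, this]
      have hb0 := ihd b hbn hb
      have hlt : ∀ i < n, a i = 0 := by
        intro i hi
        have h := congrArg (fun P => Polynomial.coeff P (a i).natDegree) (hb0 i (by omega))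
        simp only [b, Polynomial.coeff_add, Polynomial.coeff_derivative, Polynomial.coeff_C_mul,
          Polynomial.coeff_zero] at h
        rw [Polynomial.coeff_eq_zero_of_natDegree_lt (Nat.lt_succ_self _), zero_mul, zero_add,
          mul_eq_zero, mul_eq_zero, sub_eq_zero] at h
        rcases h with (h | h) | h
        · exact absurd (Nat.cast_injective h) hi.ne
        · exact absurd h hc
        · exact Polynomial.leadingCoeff_eq_zero.1 h
      rw [Finset.sum_range_succ, Finset.sum_eq_zero fun i hi => by
        rw [hlt i (Finset.mem_range.1 hi), map_zero, zero_mul], zero_add] at ha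
      intro i hi
      rcases Nat.lt_succ_iff_lt_or_eq.1 hi with h | rfl
      · exact hlt i h
      · refine aeval_T_injective ?_
        rw [map_zero]
        exact (mul_eq_zero.1 ha).resolve_right (pow_ne_zero _ he)

/-- Polynomials in `T` embed in `L`, and a relation for `e` over `K[T]` is a vanishing combination
of powers of `e`. -/
theorem algebraicIndepOn_exponential {L : Type*} [Field L] [Algebra (Tate K) L] [Algebra K L]
    [IsScalarTower K (Tate K) L] (hL : Function.Injective (algebraMap (Tate K) L))
    {c : K} (hc : c ≠ 0) {e : Tate K} (he : e ≠ 0) (hde : deriv K e = c • e) :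
    AlgebraicIndepOn K id ({algebraMap _ L e, algebraMap _ L (T K)} : Set L) := by
  have haev : ∀ P : Polynomial K, Polynomial.aeval (algebraMap _ L (T K)) P =
      algebraMap _ L (Polynomial.aeval (T K) P) := fun P =>
    Polynomial.aeval_algebraMap_apply L (T K) P
  refine AlgebraicIndepOn.insert ?_ ?_
  · rw [AlgebraicIndepOn, algebraicIndependent_singleton_iff ⟨_, Set.mem_singleton _⟩]
    refine transcendental_iff_injective.2 fun P Q h => aeval_T_injective (hL ?_)
    exact (haev P).symm.trans (Eq.trans h (haev Q))
  · rw [Set.image_id, id, transcendental_iff]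
    intro q hq
    have hco : ∀ i, ∃ P : Polynomial K,
        Polynomial.aeval (algebraMap _ L (T K)) P = (q.coeff i : L) := fun i => by
      have := (q.coeff i).2
      exact (Algebra.adjoin_singleton_eq_range_aeval K (algebraMap _ L (T K))).le this
    choose a ha using hco
    have := eq_zero_of_sum_aeval_mul_pow_eq_zero hc he hde (q.natDegree + 1) a (hL (by
      rw [map_zero, ← hq, Polynomial.aeval_eq_sum_range, map_sum]
      refine Finset.sum_congr rfl fun i _ => ?_
      rw [map_mul, ← haev, ha, map_pow]
      rfl))
    ext i
    rw [← ha]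
    rcases lt_or_ge i (q.natDegree + 1) with h | h
    · rw [this i h]; simp
    · rw [ha, Polynomial.coeff_eq_zero_of_natDegree_lt (by omega), Polynomial.coeff_zero]

/-- A solution of `e' = c e` with `e, c ≠ 0` is transcendental over `K[T]`, so that some derivation
kills `T` and sends `e` to `1`. -/
theorem exists_derivation_eq_zero_eq_one (L : Type*) [Field L] [Algebra (Tate K) L] [Algebra K L]
    [IsScalarTower K (Tate K) L] (hL : Function.Injective (algebraMap (Tate K) L))
    {c : K} (hc : c ≠ 0) {e : Tate K} (he : e ≠ 0) (hde : deriv K e = c • e) :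
    ∃ Δ : Derivation K (Tate K) L, Δ (T K) = 0 ∧ Δ e = 1 := by
  have hne : algebraMap _ L (T K) ≠ algebraMap _ L e := hL.ne fun hT => by
    rw [← hT, deriv_T] at hde
    have := congrArg (coeff 0) hde
    rw [← map_one (algebraMap K (Tate K)), coeff_algebraMap, map_smul, ← mul_one (T K),
      coeff_zero_T_mul] at this
    simp at this
  obtain ⟨Δ, hT, he1⟩ := Derivation.exists_eq_zero_eq_one hne
    (algebraicIndepOn_exponential hL hc he hde)
  exact ⟨Δ.compAlgebraMap (Tate K), hT, he1⟩

omit [CharZero K] in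
-- `ψ` sends `correction D e` to `Δ e - e' Δ T = 1`, which no non-zero `a` kills in the field `L`.
theorem eq_zero_of_smul_correction_eq_zero_of_derivation {N L : Type*} [AddCommGroup N]
    [Module (Tate K) N] [Module K N] [IsScalarTower K (Tate K) N] [Field L] [Algebra (Tate K) L]
    [Algebra K L] (hL : Function.Injective (algebraMap (Tate K) L))
    {D : Derivation K (Tate K) N} {Δ : Derivation K (Tate K) L} (ψ : N →ₗ[Tate K] L)
    (hψ : ∀ f, ψ (D f) = Δ f) {e : Tate K} (hT : Δ (T K) = 0) (he : Δ e = 1) {a : Tate K}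
    (h : a • correction D e = 0) : a = 0 := by
  have h1 := congrArg ψ h
  rw [map_zero, map_smul, correction_apply, map_sub, map_smul, hψ, hψ, hT, he, smul_zero, sub_zero,
    Algebra.smul_def, mul_one] at h1
  exact hL (h1.trans (map_zero _).symm)

/-- If `e' = c e` with `e, c ≠ 0`, then `d e - e' dT` is not a torsion element. -/
theorem eq_zero_of_smul_correction_eq_zero {c : K} (hc : c ≠ 0) {e : Tate K} (he : e ≠ 0)
    (hde : deriv K e = c • e) {a : Tate K}
    (h : a • correction (KaehlerDifferential.D K (Tate K)) e = 0) : a = 0 := by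
  have hL : Function.Injective (algebraMap (Tate K) (FractionRing (Tate K))) :=
    IsFractionRing.injective _ _
  obtain ⟨Δ, hT, he1⟩ := exists_derivation_eq_zero_eq_one (FractionRing (Tate K)) hL hc he hde
  exact eq_zero_of_smul_correction_eq_zero_of_derivation hL Δ.liftKaehlerDifferential
    Δ.liftKaehlerDifferential_comp_D hT he1 h

end Transcendence

end Tate

namespace Tate

open Filter Topology

/-! ### The series `exp (cT)` -/

section Exponential

variable (p : ℕ) [Fact p.Prime]

/-- Legendre's formula gives `(p - 1) v(n!) ≤ n`. With `m = v(c)`, equal to `2` if `p = 2` and `1`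
otherwise, `m n` exceeds `v(n!)` by at least `n / 2`. -/
theorem norm_expScale_pow_div_factorial_le (n : ℕ) :
    ‖expScale p ^ n / (n.factorial : ℚ_[p])‖ ≤ ((1 / 2 : ℝ)) ^ (n / 2) := by
  obtain ⟨m, hm, hmv⟩ : ∃ m : ℕ, expScale p = (p : ℚ_[p]) ^ m ∧
      2 * padicValNat p n.factorial + n ≤ 2 * (m * n) := by
    have hv := sub_one_mul_padicValNat_factorial (p := p) n
    by_cases h2 : p = 2
    · subst h2
      refine ⟨2, by norm_num [expScale], ?_⟩
      have : padicValNat 2 n.factorial ≤ n := by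
        rw [show 2 - 1 = 1 from rfl, one_mul] at hv
        omega
      omega
    · refine ⟨1, by rw [expScale, if_neg h2, pow_one], ?_⟩
      have hp : 2 ≤ p - 1 := by
        have := (Fact.out : p.Prime).two_le
        omega
      have := Nat.mul_le_mul_right (padicValNat p n.factorial) hp
      omega
  have hp0 : (0 : ℝ) < p := by exact_mod_cast (Fact.out : p.Prime).pos
  have hp2 : (2 : ℝ) ≤ p := by exact_mod_cast (Fact.out : p.Prime).two_le
  have hfac : (n.factorial : ℚ_[p]) ≠ 0 := by exact_mod_cast n.factorial_ne_zero
  rw [norm_div, norm_pow, hm, norm_pow, Padic.norm_p, Padic.norm_eq_zpow_neg_valuation hfac,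
    Padic.valuation_natCast, zpow_neg, zpow_natCast, div_inv_eq_mul, ← pow_mul, inv_pow]
  obtain ⟨k, hk⟩ := Nat.exists_eq_add_of_le
    (show padicValNat p n.factorial + n / 2 ≤ m * n by omega)
  rw [hk, add_assoc, pow_add, mul_inv, mul_comm, ← mul_assoc,
    mul_inv_cancel₀ (pow_ne_zero _ hp0.ne'), one_mul, one_div, inv_pow, pow_add, mul_inv]
  have h1 : ((p : ℝ) ^ k)⁻¹ ≤ 1 := inv_le_one_of_one_le₀ (one_le_pow₀ (by linarith))
  have h2 : ((p : ℝ) ^ (n / 2))⁻¹ ≤ ((2 : ℝ) ^ (n / 2))⁻¹ := by gcongr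
  calc ((p : ℝ) ^ (n / 2))⁻¹ * ((p : ℝ) ^ k)⁻¹ ≤ ((p : ℝ) ^ (n / 2))⁻¹ * 1 := by gcongr
    _ ≤ _ := by rwa [mul_one]

/-- The series `exp (c T)` lies in `ℚ_p⟨T⟩`. -/
theorem exists_exponential : ∃ e : Tate ℚ_[p],
    e.toPowerSeries = PowerSeries.rescale (expScale p) (PowerSeries.exp ℚ_[p]) := by
  refine ⟨⟨PowerSeries.rescale (expScale p) (PowerSeries.exp ℚ_[p]), (mem_iff _).2 ?_⟩, rfl⟩
  refine squeeze_zero (fun _ => norm_nonneg _) (fun n => ?_)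
    ((tendsto_pow_atTop_nhds_zero_of_lt_one (r := (1 / 2 : ℝ)) (by norm_num)
      (by norm_num)).comp (Nat.tendsto_div_const_atTop (n := 2) (by norm_num)))
  rw [PowerSeries.coeff_rescale, PowerSeries.coeff_exp]
  have h : expScale p ^ n * algebraMap ℚ ℚ_[p] (1 / n.factorial) =
      expScale p ^ n / (n.factorial : ℚ_[p]) := by
    refine Eq.trans ?_ (div_eq_mul_inv _ _).symm
    simp
  rw [h]
  exact norm_expScale_pow_div_factorial_le p n

theorem expScale_ne_zero : expScale p ≠ 0 := by
  rw [expScale]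
  split_ifs
  · norm_num
  · exact_mod_cast (Fact.out : p.Prime).ne_zero

variable {p}
variable {e : Tate ℚ_[p]}
  (he : e.toPowerSeries = PowerSeries.rescale (expScale p) (PowerSeries.exp ℚ_[p]))
include he

theorem coeff_exponential (n : ℕ) :
    coeff n e = expScale p ^ n * algebraMap ℚ ℚ_[p] (1 / n.factorial) := by
  rw [coeff_eq, he, PowerSeries.coeff_rescale, PowerSeries.coeff_exp]

theorem deriv_exponential : deriv ℚ_[p] e = expScale p • e := by
  ext n
  rw [coeff_deriv, map_smul, coeff_exponential he, coeff_exponential he, smul_eq_mul,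
    Nat.factorial_succ]
  have h1 : (n.factorial : ℚ_[p]) ≠ 0 := by exact_mod_cast n.factorial_ne_zero
  have h2 : ((n : ℚ_[p]) + 1) ≠ 0 := by exact_mod_cast n.succ_ne_zero
  simp only [one_div, map_inv₀, map_natCast]
  push_cast
  field_simp
  ring

/-- The inverse `exp (-cT)` has coefficients of the same norms, so it also converges. -/
theorem isUnit_exponential : IsUnit e := by
  let inv : PowerSeries ℚ_[p] := PowerSeries.evalNegHom e.toPowerSeries
  have hinv : inv ∈ tateAlgebra ℚ_[p] Unit := by
    rw [mem_iff]
    refine (tendsto_coeff e).congr fun n => ?_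
    change _ = ‖PowerSeries.coeff n (PowerSeries.rescale (-1 : ℚ_[p]) e.toPowerSeries)‖
    rw [PowerSeries.coeff_rescale, norm_mul, norm_pow, norm_neg, norm_one, one_pow, one_mul]
    rfl
  refine IsUnit.of_mul_eq_one ⟨inv, hinv⟩ (Subtype.ext ?_)
  change e.toPowerSeries * PowerSeries.rescale (-1 : ℚ_[p]) e.toPowerSeries = 1
  have h := congrArg (PowerSeries.rescale (expScale p))
    (PowerSeries.exp_mul_exp_neg_eq_one (A := ℚ_[p]))
  rw [map_mul, map_one, PowerSeries.evalNegHom] at h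
  rw [he, PowerSeries.rescale_rescale, mul_comm (expScale p), ← PowerSeries.rescale_rescale]
  convert h using 2

/-- Turns rescaling of `T` by an integer into a power of `e`, to which the Leibniz rule applies. -/
theorem exponential_pow (n : ℕ) :
    (e ^ n).toPowerSeries = PowerSeries.rescale (n : ℚ_[p]) e.toPowerSeries := by
  change e.toPowerSeries ^ n = _
  rw [he, ← map_pow, PowerSeries.exp_pow_eq_rescale_exp, PowerSeries.rescale_rescale,
    PowerSeries.rescale_rescale, mul_comm]

end Exponential

end Tate

/-- If a linear map into the quotient of a short exact sequence does not lift, then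
`Ext¹` into the kernel is non-zero. -/
theorem ModuleCat.nontrivial_ext_one {R N M Y W : Type} [CommRing R] [AddCommGroup N] [Module R N]
    [AddCommGroup M] [Module R M] [AddCommGroup Y] [Module R Y] [AddCommGroup W] [Module R W]
    {i : M →ₗ[R] Y} {q : Y →ₗ[R] W} (hi : Function.Injective i) (hq : Function.Surjective q)
    (hiq : Function.Exact i q) {φ : N →ₗ[R] W} (hφ : ∀ ψ : N →ₗ[R] Y, q ∘ₗ ψ ≠ φ) :
    Nontrivial (Abelian.Ext (ModuleCat.of R N) (ModuleCat.of R M) 1) := by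
  by_contra hnt
  rw [not_nontrivial_iff_subsingleton] at hnt
  let S : ShortComplex (ModuleCat R) :=
    ShortComplex.mk (ModuleCat.ofHom i) (ModuleCat.ofHom q) (by
      ext x
      exact hiq.apply_apply_eq_zero x)
  have hS : S.ShortExact :=
    { exact := (ShortComplex.moduleCat_exact_iff S).2 fun x hx => (hiq x).1 hx
      mono_f := (ModuleCat.mono_iff_injective _).2 hi
      epi_g := (ModuleCat.epi_iff_surjective _).2 hq }
  -- If `Ext¹` vanished, the connecting map would kill `φ`, so `φ` would come from a map to `Y`.
  obtain ⟨x, hx⟩ := Abelian.Ext.covariant_sequence_exact₃ (ModuleCat.of R N) hS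
    (Abelian.Ext.mk₀ (ModuleCat.ofHom φ)) (zero_add 1) (Subsingleton.elim _ _)
  obtain ⟨g, rfl⟩ := (Abelian.Ext.mk₀_bijective _ _).2 x
  rw [Abelian.Ext.mk₀_comp_mk₀] at hx
  have h := (Abelian.Ext.mk₀_bijective _ _).1 hx
  refine hφ g.hom ?_
  have h2 := congrArg ModuleCat.Hom.hom h
  exact h2

namespace Tate

open Filter Topology

/-! ### The injective quotient `K⟦X⟧ / K⟨T⟩` -/

section Extension

variable {K : Type*} [NontriviallyNormedField K] [IsUltrametricDist K]

/-- An additive map to power series that commutes with `T` up to a scalar and kills the constants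
is zero. -/
theorem eq_zero_of_map_T_mul (ρ : Tate K →+ PowerSeries K) (c : K)
    (hT : ∀ f, ρ (T K * f) = PowerSeries.X * (PowerSeries.C c * ρ f))
    (h0 : ∀ a, ρ (algebraMap K (Tate K) a) = 0) (f : Tate K) : ρ f = 0 := by
  ext n
  -- Write `f = f(0) + T g`: the coefficient of `ρ f` at `n + 1` is `c` times that of `ρ g` at `n`.
  induction n generalizing f with
  | zero =>
    obtain ⟨g, hg⟩ := exists_eq_add_T_mul f
    rw [hg, map_add, h0, zero_add, hT, PowerSeries.coeff_zero_X_mul, map_zero]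
  | succ n ih =>
    obtain ⟨g, hg⟩ := exists_eq_add_T_mul f
    rw [hg, map_add, h0, zero_add, hT, PowerSeries.coeff_succ_X_mul, PowerSeries.coeff_C_mul, ih]
    simp

/-- The quotient `K⟦X⟧ / K⟨T⟩`. -/
abbrev PowerSeriesQuotient (K : Type*) [NontriviallyNormedField K] [IsUltrametricDist K] :
    Type _ :=
  PowerSeries K ⧸ LinearMap.range (Algebra.linearMap (Tate K) (PowerSeries K))

/-- The projection `K⟦X⟧ → K⟦X⟧ / K⟨T⟩`. -/
abbrev toQuotient (K : Type*) [NontriviallyNormedField K] [IsUltrametricDist K] :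
    PowerSeries K →ₗ[Tate K] PowerSeriesQuotient K :=
  Submodule.mkQ _

theorem toQuotient_eq_zero_iff {y : PowerSeries K} :
    toQuotient K y = 0 ↔ ∃ a : Tate K, a.toPowerSeries = y := by
  rw [Submodule.mkQ_apply, Submodule.Quotient.mk_eq_zero]
  rfl

/-- In `K⟦X⟧`, `a` is `X ^ k` times a unit, so it divides `y` up to a polynomial of degree `< k`,
and that polynomial lies in `K⟨T⟩`. -/
theorem exists_smul_toQuotient_eq {a : Tate K} (ha : a ≠ 0) (m : PowerSeriesQuotient K) :
    ∃ n, a • n = m := by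
  obtain ⟨y, rfl⟩ := Submodule.mkQ_surjective _ m
  have ha' : a.toPowerSeries ≠ 0 := fun h => ha (Subtype.ext h)
  set k := a.toPowerSeries.order.toNat
  have hk : PowerSeries.X ^ k * PowerSeries.divXPowOrder a.toPowerSeries = a.toPowerSeries :=
    PowerSeries.X_pow_order_mul_divXPowOrder
  obtain ⟨v, hv⟩ := (PowerSeries.isUnit_divided_by_X_pow_order ha').exists_right_inv
  refine ⟨toQuotient K (v * PowerSeries.mk fun i => PowerSeries.coeff (i + k) y), ?_⟩
  rw [← map_smul, ← sub_eq_zero, ← map_sub, toQuotient_eq_zero_iff]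
  refine ⟨-Polynomial.aeval (T K) (PowerSeries.trunc k y), ?_⟩
  have htr : (Polynomial.aeval (T K) (PowerSeries.trunc k y)).toPowerSeries =
      (PowerSeries.trunc k y : PowerSeries K) := by
    ext n
    rw [← coeff_eq, coeff_aeval_T, Polynomial.coeff_coe]
  change -(Polynomial.aeval (T K) (PowerSeries.trunc k y)).toPowerSeries =
    a.toPowerSeries * (v * PowerSeries.mk fun i => PowerSeries.coeff (i + k) y) - y
  nth_rewrite 3 [PowerSeries.eq_X_pow_mul_shift_add_trunc k y]
  rw [htr, ← hk, ← mul_assoc, mul_assoc (PowerSeries.X ^ k), hv]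
  ring

theorem toQuotient_mk_one_ne_zero : toQuotient K (PowerSeries.mk 1) ≠ 0 := by
  intro h
  obtain ⟨a, ha⟩ := toQuotient_eq_zero_iff.1 h
  have h1 := tendsto_coeff a
  simp only [coeff_eq, ha, PowerSeries.coeff_mk, Pi.one_apply, norm_one] at h1
  exact one_ne_zero (tendsto_nhds_unique tendsto_const_nhds h1)

/-- A derivation into `K⟦X⟧` is determined by its value at `T`. -/
theorem correction_eq_zero (s : Derivation K (Tate K) (PowerSeries K)) : correction s = 0 := by
  let ρ : Tate K →+ PowerSeries K := AddMonoidHom.mk' (fun f => correction s f) (map_add _)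
  have hρT : ∀ f, ρ (T K * f) = PowerSeries.X * (PowerSeries.C 1 * ρ f) := fun f => by
    have h := (correction s).leibniz (T K) f
    rw [correction_T, smul_zero, add_zero] at h
    rw [map_one, one_mul]
    exact h
  have hρ : ∀ f, ρ f = 0 :=
    eq_zero_of_map_T_mul ρ 1 hρT fun a => (correction s).map_algebraMap a
  refine Derivation.ext fun f => ?_
  rw [Derivation.zero_apply]
  exact hρ f

variable [CompleteSpace K]

/-- `x` spans a free submodule, on which its image may be prescribed; the divisible target satisfies
Baer's criterion, so the map extends. -/
theorem exists_linearMap_eq {N : Type*} [AddCommGroup N] [Module (Tate K) N] {x : N}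
    (hx : ∀ a : Tate K, a • x = 0 → a = 0) (w : PowerSeriesQuotient K) :
    ∃ φ : N →ₗ[Tate K] PowerSeriesQuotient K, φ x = w := by
  have hinj : Function.Injective (LinearMap.toSpanSingleton (Tate K) N x) := by
    rw [injective_iff_map_eq_zero]
    exact hx
  have hB : Module.Baer (Tate K) (PowerSeriesQuotient K) :=
    Module.Baer.of_forall_exists_smul_eq fun _ ha m => exists_smul_toQuotient_eq ha m
  obtain ⟨φ, hφ⟩ := hB.extension_property _ hinj
    (LinearMap.toSpanSingleton (Tate K) (PowerSeriesQuotient K) w)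
  refine ⟨φ, ?_⟩
  have := LinearMap.congr_fun hφ 1
  rwa [LinearMap.comp_apply, LinearMap.toSpanSingleton_apply, one_smul,
    LinearMap.toSpanSingleton_apply, one_smul] at this

end Extension

/-! ### Substitution into convergent series -/

section Evaluation

variable {K : Type*} [NontriviallyNormedField K] [IsUltrametricDist K] {σ : Type*}

theorem mem_tateAlgebra_iff {f : MvPowerSeries σ K} :
    f ∈ tateAlgebra K σ ↔ Tendsto (fun m => ‖MvPowerSeries.coeff m f‖) cofinite (𝓝 0) := by
  have : f ∈ tateAlgebra K σ ↔ MvPowerSeries.IsRestricted (fun _ => 1) f := Iff.rfl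
  rw [this, MvPowerSeries.IsRestricted]
  simp [Finsupp.prod]

theorem norm_coeff_pow_le_one {u : MvPowerSeries σ K}
    (hu : ∀ m, ‖MvPowerSeries.coeff m u‖ ≤ 1) (n : ℕ) (m : σ →₀ ℕ) :
    ‖MvPowerSeries.coeff m (u ^ n)‖ ≤ 1 := by
  classical
  induction n generalizing m with
  | zero =>
    rw [pow_zero, MvPowerSeries.coeff_one]
    split_ifs <;> simp
  | succ n ih =>
    rw [pow_succ, MvPowerSeries.coeff_mul]
    refine IsUltrametricDist.norm_sum_le_of_forall_le_of_nonneg zero_le_one fun q _ => ?_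
    rw [norm_mul]
    exact mul_le_one₀ (ih _) (norm_nonneg _) (hu _)

theorem exists_norm_coeff_le (t : tateAlgebra K σ) :
    ∃ c, ∀ m, ‖MvPowerSeries.coeff m t.1‖ ≤ c := by
  have h := mem_tateAlgebra_iff.1 t.2
  have hfin : {m | ¬ ‖MvPowerSeries.coeff m t.1‖ < 1}.Finite := h.eventually (gt_mem_nhds one_pos)
  obtain ⟨c, hc⟩ := (hfin.image fun m => ‖MvPowerSeries.coeff m t.1‖).bddAbove
  refine ⟨max c 1, fun m => ?_⟩
  by_cases hm : ‖MvPowerSeries.coeff m t.1‖ < 1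
  · exact hm.le.trans (le_max_right _ _)
  · exact (hc ⟨m, hm, rfl⟩).trans (le_max_left _ _)

variable [CompleteSpace K]

/-- Substitution of an element with coefficients of norm at most `1` into elements of `K⟨T⟩`. -/
theorem exists_evaluation {u : tateAlgebra K σ} (hu : ∀ m, ‖MvPowerSeries.coeff m u.1‖ ≤ 1) :
    ∃ ev : Tate K →ₗ[K] tateAlgebra K σ, (∀ f, ev (T K * f) = u * ev f) ∧
      ∀ a, ev (algebraMap K (Tate K) a) = algebraMap K (tateAlgebra K σ) a := by
  classical
  have hterm : ∀ (f : Tate K) n m,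
      ‖coeff n f * MvPowerSeries.coeff m (u.1 ^ n)‖ ≤ ‖coeff n f‖ := fun f n m => by
    rw [norm_mul]
    exact mul_le_of_le_one_right (norm_nonneg _) (norm_coeff_pow_le_one hu n m)
  have hs : ∀ (f : Tate K) m, Summable fun n => coeff n f * MvPowerSeries.coeff m (u.1 ^ n) := by
    intro f m
    apply NonarchimedeanAddGroup.summable_of_tendsto_cofinite_zero
    rw [Nat.cofinite_eq_atTop]
    exact squeeze_zero_norm (fun n => hterm f n m) (tendsto_coeff f)
  let F : Tate K → MvPowerSeries σ K := fun f m =>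
    ∑' n, coeff n f * MvPowerSeries.coeff m (u.1 ^ n)
  have hF : ∀ f m, MvPowerSeries.coeff m (F f) =
      ∑' n, coeff n f * MvPowerSeries.coeff m (u.1 ^ n) := fun _ _ => rfl
  have hmem : ∀ f, F f ∈ tateAlgebra K σ := by
    intro f
    rw [mem_tateAlgebra_iff, Metric.tendsto_nhds]
    intro ε hε
    obtain ⟨N, hN⟩ := Metric.tendsto_atTop.1 (tendsto_coeff f) (ε / 2) (half_pos hε)
    -- Terms with `n ≥ N` are small uniformly in `m`; the finitely many others are small for almost
    -- all `m`, since each `u ^ n` is restricted.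
    have h1 : ∀ᶠ m in cofinite, ∀ n ∈ Finset.range N,
        ‖coeff n f * MvPowerSeries.coeff m (u.1 ^ n)‖ < ε / 2 := by
      rw [Filter.eventually_all_finset]
      intro n _
      have h2 := (mem_tateAlgebra_iff.1 (u ^ n).2).const_mul ‖coeff n f‖
      rw [mul_zero] at h2
      refine (h2.eventually (gt_mem_nhds (half_pos hε))).mono fun m hm => ?_
      rw [norm_mul]
      exact hm
    filter_upwards [h1] with m hm
    rw [dist_zero_right, norm_norm, hF]
    refine lt_of_le_of_lt (IsUltrametricDist.norm_tsum_le_of_forall_le fun n => ?_) (half_lt_self hε)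
    rcases lt_or_ge n N with h | h
    · exact (hm n (Finset.mem_range.2 h)).le
    · have := hN n h
      rw [dist_zero_right, norm_norm] at this
      exact (hterm f n m).trans this.le
  refine ⟨{ toFun := fun f => ⟨F f, hmem f⟩
            map_add' := fun f g => Subtype.ext (MvPowerSeries.ext fun m => ?_)
            map_smul' := fun a f => Subtype.ext (MvPowerSeries.ext fun m => ?_) },
    fun f => Subtype.ext (MvPowerSeries.ext fun m => ?_),
    fun a => Subtype.ext (MvPowerSeries.ext fun m => ?_)⟩
  · change MvPowerSeries.coeff m (F (f + g)) = MvPowerSeries.coeff m (F f + F g)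
    rw [map_add, hF, hF, hF, ← (hs f m).tsum_add (hs g m)]
    simp only [map_add, add_mul]
  · change MvPowerSeries.coeff m (F (a • f)) = MvPowerSeries.coeff m (a • F f)
    rw [map_smul, hF, hF, smul_eq_mul, ← tsum_mul_left]
    simp only [map_smul, smul_eq_mul, mul_assoc]
  · change MvPowerSeries.coeff m (F (T K * f)) = MvPowerSeries.coeff m (u.1 * F f)
    rw [hF, MvPowerSeries.coeff_mul, (hs _ m).tsum_eq_zero_add, coeff_zero_T_mul, zero_mul,
      zero_add]
    simp only [hF, ← tsum_mul_left, coeff_succ_T_mul]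
    have hq : ∀ q ∈ Finset.HasAntidiagonal.antidiagonal m, Summable fun n =>
        MvPowerSeries.coeff q.1 u.1 * (coeff n f * MvPowerSeries.coeff q.2 (u.1 ^ n)) :=
      fun q _ => (hs f q.2).mul_left _
    refine Eq.trans (tsum_congr fun n => ?_) (Summable.tsum_finsetSum hq)
    rw [pow_succ', MvPowerSeries.coeff_mul, Finset.mul_sum]
    refine Finset.sum_congr rfl fun q _ => ?_
    ring
  · change MvPowerSeries.coeff m (F (algebraMap K (Tate K) a)) =
      MvPowerSeries.coeff m (MvPowerSeries.C a)
    rw [hF, tsum_eq_single 0 fun n hn => by rw [coeff_algebraMap, if_neg hn, zero_mul],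
      coeff_algebraMap, if_pos rfl, pow_zero, MvPowerSeries.coeff_one, MvPowerSeries.coeff_C]
    split_ifs <;> simp

end Evaluation

end Tate

namespace Tate

open Filter Topology

/-! ### The square-zero extension attached to a derivation -/

section SquareZero

variable {K : Type} [NontriviallyNormedField K] [IsUltrametricDist K]
  (δ : Derivation K (Tate K) (PowerSeriesQuotient K))

/-- The algebra of all `a + y ε` with `a ∈ K⟨T⟩` and `y ∈ K⟦X⟧` in the class `δ a`. -/
def derivationExtension : Subalgebra K (DualNumber (PowerSeries K)) where
  carrier := {z | ∃ a : Tate K, a.toPowerSeries = z.fst ∧ toQuotient K z.snd = δ a}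
  mul_mem' := by
    rintro z w ⟨a, ha, hza⟩ ⟨b, hb, hwb⟩
    refine ⟨a * b, ?_, ?_⟩
    · rw [TrivSqZeroExt.fst_mul, ← ha, ← hb]
      rfl
    · have h : (z * w).snd = a • w.snd + b • z.snd := by
        rw [TrivSqZeroExt.snd_mul, ← ha, ← hb, op_smul_eq_smul]
        rfl
      rw [h, map_add, map_smul, map_smul, hza, hwb, δ.leibniz]
  add_mem' := by
    rintro z w ⟨a, ha, hza⟩ ⟨b, hb, hwb⟩
    refine ⟨a + b, ?_, ?_⟩
    · rw [TrivSqZeroExt.fst_add, ← ha, ← hb]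
      rfl
    · rw [TrivSqZeroExt.snd_add, map_add, hza, hwb, map_add]
  algebraMap_mem' r := by
    refine ⟨algebraMap K (Tate K) r, rfl, ?_⟩
    rw [δ.map_algebraMap]
    exact map_zero (toQuotient K)

theorem mem_derivationExtension {z : DualNumber (PowerSeries K)} :
    z ∈ derivationExtension δ ↔
      ∃ a : Tate K, a.toPowerSeries = z.fst ∧ toQuotient K z.snd = δ a := Iff.rfl

/-- The projection of `derivationExtension δ` onto `K⟨T⟩`. -/
def derivationExtensionProj : derivationExtension δ →ₐ[K] Tate K :=
  ((TrivSqZeroExt.fstHom K (PowerSeries K) (PowerSeries K)).comp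
    (derivationExtension δ).val).codRestrict (tateAlgebra K Unit) fun z => by
      obtain ⟨a, ha, -⟩ := z.2
      change z.1.fst ∈ _
      rw [← ha]
      exact a.2

theorem toPowerSeries_derivationExtensionProj (z : derivationExtension δ) :
    (derivationExtensionProj δ z).toPowerSeries = z.1.fst := rfl

/-- The inclusion `a ↦ a ε` of `K⟨T⟩` into `derivationExtension δ`. -/
def derivationExtensionIncl : Tate K →+ derivationExtension δ :=
  AddMonoidHom.mk' (fun m => ⟨TrivSqZeroExt.inr m.toPowerSeries, 0, rfl, by
    rw [map_zero, TrivSqZeroExt.snd_inr, toQuotient_eq_zero_iff]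
    exact ⟨m, rfl⟩⟩) fun a b => Subtype.ext (TrivSqZeroExt.inr_add _ _ _)

theorem coe_derivationExtensionIncl (m : Tate K) :
    (derivationExtensionIncl δ m : DualNumber (PowerSeries K)) =
      TrivSqZeroExt.inr m.toPowerSeries := rfl

theorem isSquareZeroExtension_derivationExtension :
    IsSquareZeroExtension K (derivationExtensionIncl δ) (derivationExtensionProj δ) where
  injective a b h := Subtype.ext (TrivSqZeroExt.inr_injective (congrArg Subtype.val h))
  exact z := by
    constructor
    · intro hz
      obtain ⟨a, ha, hza⟩ := z.2
      have h0 : z.1.fst = 0 := by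
        rw [← toPowerSeries_derivationExtensionProj, hz]
        rfl
      have ha0 : a = 0 := Subtype.ext (ha.trans h0)
      rw [ha0, map_zero, toQuotient_eq_zero_iff] at hza
      obtain ⟨m, hm⟩ := hza
      refine ⟨m, Subtype.ext (TrivSqZeroExt.ext ?_ ?_)⟩
      · rw [coe_derivationExtensionIncl, TrivSqZeroExt.fst_inr, h0]
      · rw [coe_derivationExtensionIncl, TrivSqZeroExt.snd_inr, hm]
    · rintro ⟨m, rfl⟩
      exact Subtype.ext (TrivSqZeroExt.fst_inr (PowerSeries K) m.toPowerSeries)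
  surjective a := by
    obtain ⟨y, hy⟩ := Submodule.mkQ_surjective _ (δ a)
    exact ⟨⟨TrivSqZeroExt.inl a.toPowerSeries + TrivSqZeroExt.inr y, a, by simp, by simpa using hy⟩,
      Subtype.ext (by
        change (TrivSqZeroExt.inl a.toPowerSeries + TrivSqZeroExt.inr y :
          DualNumber (PowerSeries K)).fst = a.toPowerSeries
        simp)⟩
  mul_eq_zero m m' := Subtype.ext (TrivSqZeroExt.inr_mul_inr _ _ _)
  map_smul z m := Subtype.ext (by
    change TrivSqZeroExt.inr (z.1.fst * m.toPowerSeries) =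
      z.1 * TrivSqZeroExt.inr m.toPowerSeries
    refine TrivSqZeroExt.ext ?_ ?_
    · simp
    · simp [mul_comm])

/-- Algebra homomorphisms into `derivationExtension δ` from an algebra in which one can substitute
`u = r t` into elements of `K⟨T⟩`, where `t` maps to `T`. -/
theorem correction_eq_zero_of_evaluation {B : Type*} [CommRing B] [Algebra K B]
    (φ : B →ₐ[K] DualNumber (PowerSeries K)) (hφ : ∀ b, φ b ∈ derivationExtension δ)
    {t : B} (ht : (φ t).fst = PowerSeries.X) (r : K) (ev : Tate K →ₗ[K] B)
    (hev : ∀ f, ev (T K * f) = (r • t) * ev f)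
    (hev0 : ∀ a, ev (algebraMap K (Tate K) a) = algebraMap K B a) {f g : Tate K}
    (hfg : g.toPowerSeries = PowerSeries.rescale r f.toPowerSeries) : correction δ g = 0 := by
  have hu1 : (φ (r • t)).fst = PowerSeries.C r * PowerSeries.X := by
    rw [map_smul, TrivSqZeroExt.fst_smul, ht, PowerSeries.smul_eq_C_mul]
  have hu2 : (φ (r • t)).snd = PowerSeries.C r * (φ t).snd := by
    rw [map_smul, TrivSqZeroExt.snd_smul, PowerSeries.smul_eq_C_mul]
  have hC : ∀ a, PowerSeries.rescale r (PowerSeries.C a) = PowerSeries.C a := fun a => by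
    ext n
    rw [PowerSeries.coeff_rescale, PowerSeries.coeff_C]
    split_ifs with h
    · rw [h, pow_zero, one_mul]
    · rw [mul_zero]
  have hres : ∀ f : Tate K, PowerSeries.rescale r (T K * f).toPowerSeries =
      PowerSeries.C r * PowerSeries.X * PowerSeries.rescale r f.toPowerSeries := fun f => by
    rw [← PowerSeries.rescale_X, ← map_mul]
    rfl
  -- Both components of `φ (ev f)` are forced: `f(rX)` and `(f(rX))' * (φ t).snd`. Each discrepancy,
  -- `ρ` and `ρ'`, satisfies the recursion of `eq_zero_of_map_T_mul`.
  let ρ : Tate K →+ PowerSeries K := AddMonoidHom.mk'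
    (fun f => (φ (ev f)).fst - PowerSeries.rescale r f.toPowerSeries) fun f g => by
      have : (f + g).toPowerSeries = f.toPowerSeries + g.toPowerSeries := rfl
      rw [this, map_add, map_add, map_add, TrivSqZeroExt.fst_add]
      ring
  have hρ : ∀ f, (φ (ev f)).fst = PowerSeries.rescale r f.toPowerSeries := by
    refine fun f => sub_eq_zero.1 (eq_zero_of_map_T_mul ρ r (fun f => ?_) (fun a => ?_) f)
    · change (φ (ev (T K * f))).fst - PowerSeries.rescale r (T K * f).toPowerSeries =
        PowerSeries.X * (PowerSeries.C r *
          ((φ (ev f)).fst - PowerSeries.rescale r f.toPowerSeries))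
      rw [hev, map_mul, TrivSqZeroExt.fst_mul, hu1, hres]
      ring
    · change (φ (ev (algebraMap K (Tate K) a))).fst - PowerSeries.rescale r (PowerSeries.C a) = 0
      rw [hev0, φ.commutes, hC]
      exact sub_self _
  let ρ' : Tate K →+ PowerSeries K := AddMonoidHom.mk'
    (fun f => (φ (ev f)).snd -
      PowerSeries.derivative K (PowerSeries.rescale r f.toPowerSeries) * (φ t).snd) fun f g => by
      have : (f + g).toPowerSeries = f.toPowerSeries + g.toPowerSeries := rfl
      rw [this, map_add, map_add, map_add, map_add, TrivSqZeroExt.snd_add]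
      ring
  have hρ' : ∀ f, (φ (ev f)).snd =
      PowerSeries.derivative K (PowerSeries.rescale r f.toPowerSeries) * (φ t).snd := by
    refine fun f => sub_eq_zero.1 (eq_zero_of_map_T_mul ρ' r (fun f => ?_) (fun a => ?_) f)
    · change (φ (ev (T K * f))).snd -
          PowerSeries.derivative K (PowerSeries.rescale r (T K * f).toPowerSeries) * (φ t).snd =
        PowerSeries.X * (PowerSeries.C r * ((φ (ev f)).snd -
          PowerSeries.derivative K (PowerSeries.rescale r f.toPowerSeries) * (φ t).snd))
      rw [hev, map_mul, TrivSqZeroExt.snd_mul, op_smul_eq_smul, hu1, hu2, hres, hρ,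
        Derivation.leibniz, Derivation.leibniz, PowerSeries.derivative_X, PowerSeries.derivative_C]
      simp only [smul_eq_mul]
      ring
    · change (φ (ev (algebraMap K (Tate K) a))).snd -
        PowerSeries.derivative K (PowerSeries.rescale r (PowerSeries.C a)) * (φ t).snd = 0
      rw [hev0, φ.commutes, hC, PowerSeries.derivative_C, zero_mul, sub_zero]
      rfl
  -- Membership in the extension says that the second components of `φ (ev f)` and `φ t` have
  -- classes `δ g` and `δ T`; hence `δ g = g' • δ T`, with `g'` here the derivative.
  obtain ⟨g', hg', hδ⟩ := (mem_derivationExtension δ).1 (hφ (ev f))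
  have hgg' : g' = g := Subtype.ext (hg'.trans ((hρ f).trans hfg.symm))
  obtain ⟨x, hx, hδx⟩ := (mem_derivationExtension δ).1 (hφ t)
  have hxT : x = T K := Subtype.ext (hx.trans ht)
  rw [hρ', hgg', ← hfg] at hδ
  rw [correction_apply, sub_eq_zero, ← hδ, ← hxT, ← hδx, ← map_smul]
  rfl

end SquareZero

/-! ### The Tate algebra is affinoid -/

section Affinoid

variable {K : Type*} [NontriviallyNormedField K] [IsUltrametricDist K]

theorem renameEquiv_mem_tateAlgebra {σ τ : Type*} (e : σ ≃ τ) {f : MvPowerSeries σ K}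
    (hf : f ∈ tateAlgebra K σ) : MvPowerSeries.renameEquiv K e f ∈ tateAlgebra K τ := by
  rw [mem_tateAlgebra_iff] at hf ⊢
  refine (hf.comp (Finsupp.mapDomain_injective (M := ℕ) e.symm.injective).tendsto_cofinite).congr
    fun m => ?_
  have h := MvPowerSeries.coeff_embDomain_rename e.toEmbedding f (Finsupp.mapDomain e.symm m)
  rw [Finsupp.embDomain_eq_mapDomain, ← Finsupp.mapDomain_comp] at h
  have h2 : Finsupp.mapDomain (e.toEmbedding ∘ e.symm) m = m := by
    have : (e.toEmbedding ∘ e.symm : τ → τ) = id := funext e.apply_symm_apply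
    rw [this, Finsupp.mapDomain_id]
  rw [h2] at h
  exact congrArg norm h.symm

theorem isAffinoidAlgebra : IsAffinoidAlgebra K (Tate K) := by
  let e : Fin 1 ≃ Unit := Equiv.ofUnique (Fin 1) Unit
  refine ⟨1, (((MvPowerSeries.renameEquiv K e).toAlgHom.comp
    (tateAlgebra K (Fin 1)).val).codRestrict (tateAlgebra K Unit)
      fun f => renameEquiv_mem_tateAlgebra e f.2), fun f => ?_⟩
  refine ⟨⟨MvPowerSeries.renameEquiv K e.symm f.1, renameEquiv_mem_tateAlgebra e.symm f.2⟩, ?_⟩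
  exact Subtype.ext ((MvPowerSeries.renameEquiv K e).apply_symm_apply f.1)

end Affinoid

/-! ### The non-affinoid extension and the non-zero `Ext¹` -/

section Main

variable {p : ℕ} [Fact p.Prime]

theorem exists_norm_pow_smul_le_one {σ : Type*} (t : tateAlgebra ℚ_[p] σ) :
    ∃ N : ℕ, ∀ m, ‖MvPowerSeries.coeff m (((p ^ N : ℕ) : ℚ_[p]) • t).1‖ ≤ 1 := by
  obtain ⟨c, hc⟩ := exists_norm_coeff_le t
  have hp : (1 : ℝ) < p := by exact_mod_cast (Fact.out : p.Prime).one_lt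
  obtain ⟨N, hN⟩ := pow_unbounded_of_one_lt c hp
  refine ⟨N, fun m => ?_⟩
  change ‖MvPowerSeries.coeff m (((p ^ N : ℕ) : ℚ_[p]) • t.1)‖ ≤ 1
  rw [map_smul, smul_eq_mul, norm_mul, Nat.cast_pow, norm_pow]
  have h1 : ‖(p : ℚ_[p])‖ = (p : ℝ)⁻¹ := Padic.norm_p
  rw [h1, inv_pow, inv_mul_le_iff₀ (by positivity), mul_one]
  exact (hc m).trans hN.le

/-- If `δ` does not factor through `d/dT` on `exp (c T)`, then the corresponding square-zero
extension of `ℚ_p⟨T⟩` is not affinoid. -/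
theorem not_isAffinoidAlgebra_derivationExtension {e : Tate ℚ_[p]}
    (he : e.toPowerSeries = PowerSeries.rescale (expScale p) (PowerSeries.exp ℚ_[p]))
    (δ : Derivation ℚ_[p] (Tate ℚ_[p]) (PowerSeriesQuotient ℚ_[p])) (hδ : correction δ e ≠ 0) :
    ¬ IsAffinoidAlgebra ℚ_[p] (derivationExtension δ) := by
  rintro ⟨n, φ, hφ⟩
  obtain ⟨z, hz⟩ := (isSquareZeroExtension_derivationExtension δ).surjective (T ℚ_[p])
  obtain ⟨t, rfl⟩ := hφ z
  -- The lift `t` of `T` may have coefficients of norm above `1`; only a multiple `p ^ N • t` can be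
  -- substituted.
  obtain ⟨N, hN⟩ := exists_norm_pow_smul_le_one t
  obtain ⟨ev, hev, hev0⟩ := exists_evaluation hN
  have h := correction_eq_zero_of_evaluation δ ((derivationExtension δ).val.comp φ)
    (fun b => (φ b).2) (t := t) (congrArg toPowerSeries hz) _ ev hev hev0
    (exponential_pow he (p ^ N))
  rw [Derivation.leibniz_pow, ← Nat.cast_smul_eq_nsmul (Tate ℚ_[p]), smul_smul] at h
  have hunit : IsUnit (((p ^ N : ℕ) : Tate ℚ_[p]) * e ^ (p ^ N - 1)) := by
    refine IsUnit.mul ?_ ((isUnit_exponential he).pow _)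
    rw [← map_natCast (algebraMap ℚ_[p] (Tate ℚ_[p]))]
    refine (IsUnit.mk0 _ ?_).map _
    exact_mod_cast pow_ne_zero N (Fact.out : p.Prime).ne_zero
  exact hδ (hunit.smul_eq_zero.1 h)

theorem correction_compDer {K N N' : Type*} [NontriviallyNormedField K] [IsUltrametricDist K]
    [AddCommGroup N] [Module (Tate K) N] [Module K N] [IsScalarTower K (Tate K) N]
    [AddCommGroup N'] [Module (Tate K) N'] [Module K N'] [IsScalarTower K (Tate K) N']
    (φ : N →ₗ[Tate K] N') (D : Derivation K (Tate K) N) (f : Tate K) :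
    correction (φ.compDer D) f = φ (correction D f) := by
  rw [correction_apply, correction_apply, map_sub, map_smul]
  rfl

/-- A linear map to `K⟦X⟧ / K⟨T⟩` that does not kill some `D f - f' D T` has no lift to `K⟦X⟧`. -/
theorem nontrivial_ext_one {K N : Type} [NontriviallyNormedField K] [IsUltrametricDist K]
    [AddCommGroup N] [Module (Tate K) N] [Module K N] [IsScalarTower K (Tate K) N]
    (D : Derivation K (Tate K) N) {f : Tate K} {φ : N →ₗ[Tate K] PowerSeriesQuotient K}
    (hφ : φ (correction D f) ≠ 0) :
    Nontrivial (Abelian.Ext (ModuleCat.of (Tate K) N) (ModuleCat.of (Tate K) (Tate K)) 1) := by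
  refine ModuleCat.nontrivial_ext_one (i := Algebra.linearMap (Tate K) (PowerSeries K))
    (q := toQuotient K) Subtype.val_injective (Submodule.mkQ_surjective _)
    (LinearMap.exact_map_mkQ_range _) (φ := φ) fun ψ hψ => hφ ?_
  -- Composing a lift `ψ` with `D` gives a derivation into `K⟦X⟧`, whose correction vanishes.
  have h : ψ (correction D f) = 0 := by
    rw [← correction_compDer, correction_eq_zero, Derivation.zero_apply]
  rw [← hψ, LinearMap.comp_apply, h, map_zero]

/-- If `D e - e' D T` is torsion-free for the exponential `e = exp (c T)`, then `Ext¹` of the target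
of `D` is non-zero and there is a non-affinoid square-zero extension. -/
theorem nontrivial_ext_one_and_exists_not_isAffinoidAlgebra {e : Tate ℚ_[p]}
    (he : e.toPowerSeries = PowerSeries.rescale (expScale p) (PowerSeries.exp ℚ_[p]))
    {N : Type} [AddCommGroup N] [Module (Tate ℚ_[p]) N] [Module ℚ_[p] N]
    [IsScalarTower ℚ_[p] (Tate ℚ_[p]) N] (D : Derivation ℚ_[p] (Tate ℚ_[p]) N)
    (hD : ∀ a : Tate ℚ_[p], a • correction D e = 0 → a = 0) :
    Nontrivial (Abelian.Ext (ModuleCat.of (Tate ℚ_[p]) N)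
      (ModuleCat.of (Tate ℚ_[p]) (Tate ℚ_[p])) 1) ∧
    ∃ (E : Type) (_ : CommRing E) (_ : Algebra ℚ_[p] E) (i : Tate ℚ_[p] →+ E)
      (π : E →ₐ[ℚ_[p]] Tate ℚ_[p]),
      IsSquareZeroExtension ℚ_[p] i π ∧ ¬ IsAffinoidAlgebra ℚ_[p] E := by
  -- The target value is the class of `1 / (1 - X)`, non-zero because its coefficients do not tend
  -- to `0`.
  obtain ⟨φ, hφ⟩ := exists_linearMap_eq hD (toQuotient ℚ_[p] (PowerSeries.mk 1))
  have hφ0 : φ (correction D e) ≠ 0 := by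
    rw [hφ]
    exact toQuotient_mk_one_ne_zero
  refine ⟨nontrivial_ext_one D hφ0, derivationExtension (φ.compDer D), inferInstance,
    inferInstance, derivationExtensionIncl _, derivationExtensionProj _,
    isSquareZeroExtension_derivationExtension _,
    not_isAffinoidAlgebra_derivationExtension he _ ?_⟩
  rwa [correction_compDer]

end Main

end Tate

end

theorem mainTheorem12 (p : ℕ) [Fact p.Prime] :
    -- `A = ℚ_p⟨T⟩` is an affinoid algebra; there is a finitely generated `M` with `Ext¹ ≠ 0`,
    -- and a square-zero extension `E` of `A` by `M` which is not affinoid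
    (IsAffinoidAlgebra ℚ_[p] (Tate ℚ_[p]) ∧
      ∃ (M : Type) (_ : AddCommGroup M) (_ : Module (Tate ℚ_[p]) M),
        Module.Finite (Tate ℚ_[p]) M ∧
        Nontrivial (Abelian.Ext (ModuleCat.of (Tate ℚ_[p]) (Ω[Tate ℚ_[p]⁄ℚ_[p]]))
          (ModuleCat.of (Tate ℚ_[p]) M) 1) ∧
        ∃ (E : Type) (_ : CommRing E) (_ : Algebra ℚ_[p] E) (i : M →+ E)
          (π : E →ₐ[ℚ_[p]] Tate ℚ_[p]),
          IsSquareZeroExtension ℚ_[p] i π ∧ ¬ IsAffinoidAlgebra ℚ_[p] E) ∧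
    -- `Ω^rig` is the universal finite differential module, and `π : Ω¹ → Ω^rig` is surjective
    IsUniversalFiniteDerivation (Tate.dRig ℚ_[p]) ∧
    Function.Surjective (Tate.toOmegaRig ℚ_[p]) ∧
    -- `ker π` is divisible, injective, and not projective
    (∀ a : Tate ℚ_[p], a ≠ 0 → ∀ m ∈ LinearMap.ker (Tate.toOmegaRig ℚ_[p]),
      ∃ n ∈ LinearMap.ker (Tate.toOmegaRig ℚ_[p]), a • n = m) ∧
    Module.Injective (Tate ℚ_[p]) (LinearMap.ker (Tate.toOmegaRig ℚ_[p])) ∧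
    ¬ Module.Projective (Tate ℚ_[p]) (LinearMap.ker (Tate.toOmegaRig ℚ_[p])) ∧
    -- `ker π` is non-zero: it contains `d(exp(cT)) - c exp(cT) dT ≠ 0`
    ∃ e : Tate ℚ_[p],
      e.toPowerSeries = PowerSeries.rescale (expScale p) (PowerSeries.exp ℚ_[p]) ∧
      KaehlerDifferential.D ℚ_[p] (Tate ℚ_[p]) e -
          (expScale p • e) • KaehlerDifferential.D ℚ_[p] (Tate ℚ_[p]) (Tate.T ℚ_[p]) ∈
        LinearMap.ker (Tate.toOmegaRig ℚ_[p]) ∧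
      KaehlerDifferential.D ℚ_[p] (Tate ℚ_[p]) e -
          (expScale p • e) • KaehlerDifferential.D ℚ_[p] (Tate ℚ_[p]) (Tate.T ℚ_[p]) ≠ 0 := by
  obtain ⟨e, he⟩ := Tate.exists_exponential p
  have hde := Tate.deriv_exponential he
  have hspan := KaehlerDifferential.span_range_derivation ℚ_[p] (Tate ℚ_[p])
  have htf {a : Tate ℚ_[p]} :=
    Tate.eq_zero_of_smul_correction_eq_zero (Tate.expScale_ne_zero p)
      (Tate.isUnit_exponential he).ne_zero hde (a := a)
  have hne := Tate.correction_ne_zero (D := KaehlerDifferential.D ℚ_[p] (Tate ℚ_[p])) fun _ => htf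
  have heq : Tate.correction (KaehlerDifferential.D ℚ_[p] (Tate ℚ_[p])) e =
      KaehlerDifferential.D ℚ_[p] (Tate ℚ_[p]) e -
        (expScale p • e) • KaehlerDifferential.D ℚ_[p] (Tate ℚ_[p]) (Tate.T ℚ_[p]) := by
    rw [← hde]
    rfl
  obtain ⟨hExt, hE⟩ := Tate.nontrivial_ext_one_and_exists_not_isAffinoidAlgebra he
    (KaehlerDifferential.D ℚ_[p] (Tate ℚ_[p])) fun _ => htf
  exact ⟨⟨Tate.isAffinoidAlgebra, Tate ℚ_[p], inferInstance, inferInstance, inferInstance,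
      hExt, hE⟩,
    Tate.isUniversalFiniteDerivation_dRig, Tate.toOmegaRig_surjective,
    fun _ ha _ hm => Tate.exists_smul_eq_of_mem_ker Tate.toOmegaRig_D hspan ha hm,
    Tate.injective_ker Tate.toOmegaRig_D hspan,
    Tate.not_projective_ker Tate.toOmegaRig_D hspan hne,
    e, he, heq ▸ Tate.correction_mem_ker Tate.toOmegaRig_D e, heq ▸ hne⟩
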